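/- **Conventions.** Formulas are first-order formulas with equality in the language of arithmetic $\{0,S,+,\times\}$; the intended interpretation is $\mathbb N$. A *theory* is a set $T$ of sentences closed under logical consequence; $T\vdash A$ means $A\in T$, and $T$ *extends* $T'$ if $T'\subseteq T$. $T$ is *consistent* if there is no sentence $A$ with $T\vdash A$ and $T\vdash\neg A$. $\mathsf{PA}$ is the theory axiomatized by - $\forall x\,\neg\,Sx=0$, $\ \forall x,y\,(Sx=Sy\to x=y)$, $\ \forall x\,(x=0\lor\exists y\,Sy=x)$, - $\forall x\;x+0=x$, $\ \forall x,y\;x+Sy=S(x+y)$, $\ \forall x\;x\times0=0$, $\ \forall x,y\;x\times Sy=x+(x\times y)$, - the universal closure of $(P(0)\land\forall x\,(P(x)\to P(Sx)))\to\forall x\,P(x)$ for every formula $P$ (possibly with parameters). Strings over the finite alphabet $0,S,+,\times,=,\bot,\neg,\to,\forall,v,'$ are identified with natural numbers by reading the symbols as the nonzero digits of a numeral in base 12; formulas are strings in prefix notation, so the number of $\neg A$ is $\neg\frown A$, where $x\frown y$ is the number written with the digits of $x$ followed by those of $y$. For $n\in\mathbb N$, $\ulcorner n\urcorner$ is the numeral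 $S\cdots S0$ ($n$ times $S$), and $\ulcorner A\urcorner$ is the numeral of the number of the sentence (or symbol) $A$. $T$ is *computably enumerable* if there is a computable $V:\mathbb N^2\to\{0,1\}$ such that for every $x$: if $x$ is the number of a sentence in $T$ then $V(p,x)=1$ for some $p$, and otherwise $V(p,x)=0$ for all $p$. A formula $F(x_1,\dots,x_k,y)$ *represents* $f:\mathbb N^k\to\mathbb N$ in $T$ if, whenever $f(\mathbf x)=y$, $T\vdash(\exists!y\,F(\ulcorner\mathbf x\urcorner,y))\land F(\ulcorner\mathbf x\urcorner,\ulcorner y\urcorner)$; it does so *correctly* if moreover, for all $\mathbf x,y$, $F(\ulcorner\mathbf x\urcorner,\ulcorner y\urcorner)$ is true in $\mathbb N$ if and only if $f(\mathbf x)=y$. For a formula $P$ with one free variable, $P(f(\mathbf r))$ abbreviates $(\exists!y\,F(\mathbf r,y))\land\exists y\,(F(\mathbf r,y)\land P(y))$. A formula $\mathrm{Pvb}(x)$ with one free variable is a *strong provability predicate* for $T$ if for all sentences $A,B$: - (correctness) $\mathrm{Pvb}(\ulcorner A\urcorner)$ is true in $\mathbb N$ if and only if $T\vdash A$; - (representability)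 if $T\vdash A$, then $T\vdash\mathrm{Pvb}(\ulcorner A\urcorner)$; - (distributivity) $T\vdash\mathrm{Pvb}(\ulcorner A\to B\urcorner)\to(\mathrm{Pvb}(\ulcorner A\urcorner)\to\mathrm{Pvb}(\ulcorner B\urcorner))$; - (re-representability) $T\vdash\mathrm{Pvb}(\ulcorner A\urcorner)\to\mathrm{Pvb}(\ulcorner\mathrm{Pvb}(\ulcorner A\urcorner)\urcorner)$. **Theorem (Second Incompleteness Theorem).** Let $T$ be a computably enumerable extension of $\mathsf{PA}$. Then there exists a consistency statement of the form $$\mathrm{Con}\;:=\;\neg\exists x\,\bigl(\mathrm{Pvb}(x)\land\mathrm{Pvb}(\ulcorner\neg\urcorner\frown x)\bigr),$$ where $\mathrm{Pvb}$ is a strong provability predicate for $T$ and the concatenation function $\frown$ is correctly represented in $T$. Furthermore, if $T$ is consistent, then every sentence $\mathrm{Con}$ of this form, for any strong provability predicate $\mathrm{Pvb}$ for $T$ and any formula representing $\frown$ in $T$, is not provable in $T$. -/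

import Mathlib

open FirstOrder

namespace Arith

/-! ### The language of arithmetic and its standard model -/

/-- The function symbols `0`, `S`, `+`, `×`. -/
inductive Func : ℕ → Type
  | zero : Func 0
  | succ : Func 1
  | add : Func 2
  | mul : Func 2

/-- The first-order language (with equality) of arithmetic. -/
def lang : Language where
  Functions := Func
  Relations := fun _ => Empty

def tZero {α : Type} : lang.Term α := Language.Term.func (L := lang) Func.zero ![]
def tSucc {α : Type} (t : lang.Term α) : lang.Term α :=
  Language.Term.func (L := lang) Func.succ ![t]
def tAdd {α : Type} (s t : lang.Term α) : lang.Term α :=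
  Language.Term.func (L := lang) Func.add ![s, t]
def tMul {α : Type} (s t : lang.Term α) : lang.Term α :=
  Language.Term.func (L := lang) Func.mul ![s, t]

/-- The numeral `S ⋯ S 0` with `n` occurrences of `S`. -/
def numeral {α : Type} : ℕ → lang.Term α
  | 0 => tZero
  | n + 1 => tSucc (numeral n)

/-- The intended interpretation of the language: the natural numbers. -/
instance standardModel : lang.Structure ℕ where
  funMap := fun f v => match f, v with
    | Func.zero, _ => 0
    | Func.succ, v => v 0 + 1
    | Func.add, v => v 0 + v 1
    | Func.mul, v => v 0 * v 1
  RelMap := fun r _ => r.elim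

/-! ### Substitution

In a `BoundedFormula Empty n` the variables in scope are `&0, …, &(n-1)`, and a quantifier in front
of a `BoundedFormula Empty (n+1)` binds `&n`. -/

/-- `app φ ![t₁, …, tₖ]` is `φ(t₁, …, tₖ)`, where `φ` has the free variables `0, …, k-1`. -/
def app {k n : ℕ} (φ : lang.Formula (Fin k)) (ts : Fin k → lang.Term (Empty ⊕ Fin n)) :
    lang.BoundedFormula Empty n :=
  Language.BoundedFormula.relabel (n := n) (k := 0) id
    (Language.BoundedFormula.subst φ ts : lang.Formula (Empty ⊕ Fin n))

/-- The same term, in a scope with one more bound variable. -/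
def weaken {n : ℕ} (t : lang.Term (Empty ⊕ Fin n)) : lang.Term (Empty ⊕ Fin (n + 1)) :=
  t.relabel (Sum.map id Fin.castSucc)

/-! ### Robinson arithmetic and Peano arithmetic -/

open scoped FirstOrder

def axS0 : lang.Sentence := ∀' ∼(tSucc (&0) =' tZero)
def axS1 : lang.Sentence := ∀' ∀' ((tSucc (&0) =' tSucc (&1)) ⟹ (&0 =' &1))
def axS2 : lang.Sentence := ∀' ((&0 =' tZero) ⊔ ∃' (tSucc (&1) =' &0))
def axA0 : lang.Sentence := ∀' (tAdd (&0) tZero =' &0)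
def axA1 : lang.Sentence := ∀' ∀' (tAdd (&0) (tSucc (&1)) =' tSucc (tAdd (&0) (&1)))
def axM0 : lang.Sentence := ∀' (tMul (&0) tZero =' tZero)
def axM1 : lang.Sentence := ∀' ∀' (tMul (&0) (tSucc (&1)) =' tAdd (&0) (tMul (&0) (&1)))

/-- Induction for `P`, whose last variable is the induction variable and whose other variables are
parameters: the universal closure of `(P(0) ∧ ∀ x, (P(x) → P(Sx))) → ∀ x, P(x)`. -/
def axInduction {k : ℕ} (P : lang.Formula (Fin (k + 1))) : lang.Sentence :=
  Language.BoundedFormula.alls (n := k)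
    ((app P (Fin.snoc (fun i => &i) tZero) ⊓
        ∀' (app P (fun i => &i) ⟹
          app P (Fin.snoc (fun i => &(Fin.castSucc i)) (tSucc (&(Fin.last k)))))) ⟹
      ∀' app P (fun i => &i))

def axiomsQ : lang.Theory := {axS0, axS1, axS2, axA0, axA1, axM0, axM1}

def axiomsPA : lang.Theory :=
  axiomsQ ∪ {A | ∃ (k : ℕ) (P : lang.Formula (Fin (k + 1))), A = axInduction P}

/-- A set of sentences is a theory when it is closed under logical consequence. For such a `T`,
`T ⊢ A` means `A ∈ T`. -/
def IsTheory (T : lang.Theory) : Prop := ∀ A : lang.Sentence, T ⊨ᵇ A → A ∈ T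

/-- Peano arithmetic, as a deductively closed set of sentences. -/
def PA : lang.Theory := {A | axiomsPA ⊨ᵇ A}

def Consistent (T : lang.Theory) : Prop := ¬ ∃ A : lang.Sentence, A ∈ T ∧ ∼A ∈ T

/-! ### Sentences as strings, strings as numbers -/

/-- The alphabet `0 S + × = ⊥ ¬ → ∀ v '`. -/
inductive Symbol
  | zero | succ | add | mul | eq | bot | neg | imp | all | var | tick

/-- The symbols are the nonzero digits in base 12. -/
def Symbol.digit : Symbol → ℕ
  | zero => 1
  | succ => 2
  | add => 3
  | mul => 4
  | eq => 5
  | bot => 6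
  | neg => 7
  | imp => 8
  | all => 9
  | var => 10
  | tick => 11

/-- The variable number `i`, written `v'⋯'` with `i` ticks. -/
def varString (i : ℕ) : List Symbol := Symbol.var :: List.replicate i Symbol.tick

/-- Terms in prefix notation. -/
def termString {n : ℕ} : lang.Term (Empty ⊕ Fin n) → List Symbol
  | .var (.inl e) => e.elim
  | .var (.inr i) => varString i
  | .func (l := 0) Func.zero _ => [Symbol.zero]
  | .func (l := 1) Func.succ ts => Symbol.succ :: termString (ts 0)
  | .func (l := 2) Func.add ts => Symbol.add :: (termString (ts 0) ++ termString (ts 1))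
  | .func (l := 2) Func.mul ts => Symbol.mul :: (termString (ts 0) ++ termString (ts 1))

/-- Formulas in prefix notation. The negation `∼φ`, which is the formula `φ ⟹ ⊥`, is written
`¬φ`. -/
def formulaString : {n : ℕ} → lang.BoundedFormula Empty n → List Symbol
  | _, .falsum => [Symbol.bot]
  | _, .equal s t => Symbol.eq :: (termString s ++ termString t)
  | _, .rel r _ => r.elim
  | _, .imp φ .falsum => Symbol.neg :: formulaString φ
  | _, .imp φ ψ => Symbol.imp :: (formulaString φ ++ formulaString ψ)
  | n, .all φ => Symbol.all :: (varString n ++ formulaString φ)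

/-- The number written in base 12 with the symbols of the string as its digits, the first symbol
being the most significant digit. -/
def stringNumber (s : List Symbol) : ℕ := Nat.ofDigits 12 (s.map Symbol.digit).reverse

/-- The number that the sentence `A` is. -/
def code (A : lang.Sentence) : ℕ := stringNumber (formulaString A)

/-- The number written (in base 12) with the digits of `x` followed by the digits of `y`. -/
def concat (x y : ℕ) : ℕ := Nat.ofDigits 12 (Nat.digits 12 y ++ Nat.digits 12 x)

/-! ### Computably enumerable theories -/

/-- `pc p x` accepts for some `p` if `x` is a theorem of `T`, and for no `p` otherwise. -/
def IsProofVerifier (T : lang.Theory) (pc : ℕ → ℕ → Bool) : Prop :=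
  ∀ x : ℕ, ((∃ A ∈ T, code A = x) → ∃ p, pc p x = true) ∧
    ((¬ ∃ A ∈ T, code A = x) → ∀ p, pc p x = false)

def ComputablyEnumerable (T : lang.Theory) : Prop :=
  ∃ pc : ℕ → ℕ → Bool, Computable₂ pc ∧ IsProofVerifier T pc

/-! ### Representations of functions -/

/-- `∃! y, F(r, y)`, that is, `∃ y, (F(r, y) ∧ ∀ z, (F(r, z) → z = y))`. -/
def existsUniqueValue {k n : ℕ} (F : lang.Formula (Fin (k + 1)))
    (r : Fin k → lang.Term (Empty ⊕ Fin n)) : lang.BoundedFormula Empty n :=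
  ∃' (app F (Fin.snoc (fun i => weaken (r i)) (&(Fin.last n))) ⊓
    ∀' (app F (Fin.snoc (fun i => weaken (weaken (r i))) (&(Fin.last (n + 1)))) ⟹
      (&(Fin.last (n + 1)) =' &(Fin.castSucc (Fin.last n)))))

/-- The formula `F` represents `f` in `T`: whenever `f(x) = y`, the theory `T` proves
`(∃! y, F(x, y)) ∧ F(x, y)` for the numerals of `x` and `y`. -/
def Represents (T : lang.Theory) {k : ℕ} (f : (Fin k → ℕ) → ℕ)
    (F : lang.Formula (Fin (k + 1))) : Prop :=
  ∀ (x : Fin k → ℕ) (y : ℕ), f x = y →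
    (existsUniqueValue F (fun i => numeral (x i)) ⊓
      app F (Fin.snoc (fun i => numeral (x i)) (numeral y)) : lang.Sentence) ∈ T

/-- A representation that is moreover correct in the intended interpretation. -/
def CorrectlyRepresents (T : lang.Theory) {k : ℕ} (f : (Fin k → ℕ) → ℕ)
    (F : lang.Formula (Fin (k + 1))) : Prop :=
  Represents T f F ∧ ∀ (x : Fin k → ℕ) (y : ℕ),
    ℕ ⊨ (app F (Fin.snoc (fun i => numeral (x i)) (numeral y)) : lang.Sentence) ↔ f x = y

/-- `P(f(r))` for a function `f` with representation `F`, that is,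
`(∃! y, F(r, y)) ∧ ∃ y, (F(r, y) ∧ P(y))`. -/
def atValue {k n : ℕ} (P : lang.Formula (Fin 1)) (F : lang.Formula (Fin (k + 1)))
    (r : Fin k → lang.Term (Empty ⊕ Fin n)) : lang.BoundedFormula Empty n :=
  existsUniqueValue F r ⊓
    ∃' (app F (Fin.snoc (fun i => weaken (r i)) (&(Fin.last n))) ⊓ app P ![&(Fin.last n)])

/-! ### Provability predicates and consistency statements -/

/-- `P(A)`: the sentence saying that the predicate `P` holds of the number of `A`. -/
def holdsOf (P : lang.Formula (Fin 1)) (A : lang.Sentence) : lang.Sentence :=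
  app P ![numeral (code A)]

/-- Strong provability predicates: correctness, together with the three derivability conditions. -/
structure IsStrongProvabilityPredicate (T : lang.Theory) (Pvb : lang.Formula (Fin 1)) : Prop where
  correctness : ∀ A : lang.Sentence, ℕ ⊨ holdsOf Pvb A ↔ A ∈ T
  representability : ∀ A : lang.Sentence, A ∈ T → holdsOf Pvb A ∈ T
  distributivity : ∀ A B : lang.Sentence,
    (holdsOf Pvb (A ⟹ B) ⟹ (holdsOf Pvb A ⟹ holdsOf Pvb B)) ∈ T
  reRepresentability : ∀ A : lang.Sentence,
    (holdsOf Pvb A ⟹ holdsOf Pvb (holdsOf Pvb A)) ∈ T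

/-- Concatenation as a function of two arguments. -/
def concatFun (v : Fin 2 → ℕ) : ℕ := concat (v 0) (v 1)

/-- `¬ ∃ x, (Pvb(x) ∧ Pvb(¬ ⌢ x))`, where `Cat` is the formula that represents `⌢`. -/
def consistencyStatement (Pvb : lang.Formula (Fin 1)) (Cat : lang.Formula (Fin 3)) :
    lang.Sentence :=
  ∼(∃' (app Pvb ![&0] ⊓ atValue Pvb Cat ![numeral (stringNumber [Symbol.neg]), &0]))

end Arith

open scoped FirstOrder

namespace Arith

open Language

/-! ### Semantics of the syntactic operations -/

section Raw

variable {M : Type} [lang.Structure M]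

/-! Unprovability is Gödel's argument. Let `G` be equivalent to `¬Pvb(⌜G⌝)` (`exists_fixedPoint`).
Since `G → ¬Pvb(⌜G⌝)` is in `T`, representability and distributivity give `Pvb(⌜G⌝) →
Pvb(⌜¬Pvb(⌜G⌝)⌝)` in `T`, and re-representability gives `Pvb(⌜G⌝) → Pvb(⌜Pvb(⌜G⌝)⌝)`. So in `T` the
sentence `Pvb(⌜G⌝)` refutes `Con`. If `Con` were in `T`, then `¬Pvb(⌜G⌝)` would be, hence `G`, hence
`Pvb(⌜G⌝)` by representability: `T` would be inconsistent.

The work lies in the existence of a strong provability predicate. Re-representability usually rests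
on a formalized Σ₁-completeness theorem. Here it is built in: `Pvb(x)` says that `x` is derivable
from theorems of `T` by modus ponens and by the rule that leads from `A` to `Pvb(⌜A⌝)`. The
predicate refers to itself through a number `e` (`exists_code_selfRefFormula`). Distributivity and
re-representability then merely say that derivability is closed under its two rules
(`Provable.of_rule`). This holds in every model of `PA`, because definable bounded sets are coded
there (`Def.exists_code`) and two derivations can be merged. Correctness is an induction on
derivations in `ℕ`; the second rule is sound because a derivation in `ℕ` remains one in every model
(`Provable.natCast`).

All of this is semantic: a sentence is in `T` once it holds in all models of `T`
(`mem_of_forall_models`), and those are discretely ordered semirings with induction for definable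
predicates. Computable enumerability enters through `sigma1_of_partrec`, and the representation of
`⌢` through `exists_formula_graph`. -/

def zeroM (M : Type) [lang.Structure M] : M := Structure.funMap (L := lang) Func.zero ![]
def succM (x : M) : M := Structure.funMap (L := lang) Func.succ ![x]
def addM (x y : M) : M := Structure.funMap (L := lang) Func.add ![x, y]
def mulM (x y : M) : M := Structure.funMap (L := lang) Func.mul ![x, y]

@[simp] theorem realize_tZero {α : Type} (v : α → M) :
    (tZero : lang.Term α).realize v = zeroM M := by
  simp only [tZero, Term.realize, zeroM]
  congr 1
  exact Subsingleton.elim _ _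

@[simp] theorem realize_tSucc {α : Type} (v : α → M) (t : lang.Term α) :
    (tSucc t).realize v = succM (t.realize v) := by
  simp only [tSucc, Term.realize, succM]
  congr 1
  ext i; fin_cases i; rfl

@[simp] theorem realize_tAdd {α : Type} (v : α → M) (s t : lang.Term α) :
    (tAdd s t).realize v = addM (s.realize v) (t.realize v) := by
  simp only [tAdd, Term.realize, addM]
  congr 1
  ext i; fin_cases i <;> rfl

@[simp] theorem realize_tMul {α : Type} (v : α → M) (s t : lang.Term α) :
    (tMul s t).realize v = mulM (s.realize v) (t.realize v) := by
  simp only [tMul, Term.realize, mulM]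
  congr 1
  ext i; fin_cases i <;> rfl

@[simp] theorem realize_app {k n : ℕ} (φ : lang.Formula (Fin k))
    (ts : Fin k → lang.Term (Empty ⊕ Fin n)) (v : Empty → M) (xs : Fin n → M) :
    (app φ ts).Realize v xs ↔ φ.Realize (fun i => (ts i).realize (Sum.elim v xs)) := by
  unfold app
  rw [show (BoundedFormula.relabel (n := n) (k := 0) id (BoundedFormula.subst φ ts)).Realize v xs ↔
    _ from BoundedFormula.realize_relabel]
  rw [BoundedFormula.realize_subst, Formula.Realize]
  have h1 : (Sum.elim v (xs ∘ Fin.castAdd 0) ∘ id : Empty ⊕ Fin n → M) = Sum.elim v xs := by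
    ext i; rcases i with i | i <;> rfl
  rw [h1]
  exact iff_of_eq (congrArg _ (Subsingleton.elim _ _))

@[simp] theorem realize_weaken {n : ℕ} (t : lang.Term (Empty ⊕ Fin n)) (v : Empty → M)
    (xs : Fin n → M) (x : M) :
    (weaken t).realize (Sum.elim v (Fin.snoc xs x)) = t.realize (Sum.elim v xs) := by
  unfold weaken
  rw [Term.realize_relabel]
  congr 1
  ext i; rcases i with i | i
  · exact i.elim
  · simp

/-- Existential quantification over the first variable. -/
def exF {k : ℕ} (φ : lang.Formula (Fin (k + 1))) : lang.Formula (Fin k) :=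
  (BoundedFormula.relabel (n := 1) (k := 0)
    (Fin.cons (Sum.inr 0) Sum.inl : Fin (k + 1) → Fin k ⊕ Fin 1) φ).ex

@[simp] theorem realize_exF {k : ℕ} (φ : lang.Formula (Fin (k + 1))) (v : Fin k → M) :
    (exF φ).Realize v ↔ ∃ x, φ.Realize (Fin.cons x v : Fin (k + 1) → M) := by
  unfold exF
  rw [Formula.Realize, BoundedFormula.realize_ex]
  refine exists_congr fun x => ?_
  rw [show (BoundedFormula.relabel (n := 1) (k := 0)
    (Fin.cons (Sum.inr 0) Sum.inl : Fin (k + 1) → Fin k ⊕ Fin 1) φ).Realize v _ ↔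
    _ from BoundedFormula.realize_relabel, Formula.Realize]
  have h1 : (Sum.elim v ((Fin.snoc default x : Fin 1 → M) ∘ Fin.castAdd 0) ∘
      (Fin.cons (Sum.inr 0) Sum.inl : Fin (k + 1) → Fin k ⊕ Fin 1)) = Fin.cons x v := by
    ext i
    refine Fin.cases ?_ (fun i => ?_) i
    · simp [Fin.snoc]
    · simp
  rw [h1]
  exact iff_of_eq (congrArg _ (Subsingleton.elim _ _))

theorem snoc_comp_cons {M : Type} {k : ℕ} (p : Fin k → M) (x : M) :
    (Fin.snoc p x : Fin (k + 1) → M) ∘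
      (Fin.cons (Fin.last k) Fin.castSucc : Fin (k + 1) → Fin (k + 1)) = Fin.cons x p := by
  ext i
  refine Fin.cases ?_ (fun i => ?_) i <;> simp

/-- `axInduction` has its induction variable in the last place, whereas `Fin.cons` and `exF` work on
the first; the relabelled formula `P` mediates between the two. -/
theorem models_axiomsPA_induction (h : M ⊨ axiomsPA) {k : ℕ} (φ : lang.Formula (Fin (k + 1)))
    (p : Fin k → M) (h0 : φ.Realize (Fin.cons (zeroM M) p : Fin (k + 1) → M))
    (h1 : ∀ x, φ.Realize (Fin.cons x p : Fin (k + 1) → M) →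
      φ.Realize (Fin.cons (succM x) p : Fin (k + 1) → M)) (x : M) :
    φ.Realize (Fin.cons x p : Fin (k + 1) → M) := by
  let P : lang.Formula (Fin (k + 1)) :=
    φ.relabel (Fin.cons (Fin.last k) Fin.castSucc : Fin (k + 1) → Fin (k + 1))
  have hP : ∀ x, P.Realize (Fin.snoc p x : Fin (k + 1) → M) ↔
      φ.Realize (Fin.cons x p : Fin (k + 1) → M) := fun x => by
    simp only [P]
    rw [Formula.realize_relabel, snoc_comp_cons]
  have hax : M ⊨ axInduction P :=
    Theory.realize_sentence_of_mem (T := axiomsPA) (Set.mem_union_right _ ⟨k, P, rfl⟩)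
  unfold axInduction Sentence.Realize at hax
  rw [BoundedFormula.realize_alls] at hax
  have := hax p
  simp only [BoundedFormula.realize_imp, BoundedFormula.realize_inf, realize_app,
    BoundedFormula.realize_all] at this
  have e1 : (fun i => Term.realize (Sum.elim (default : Empty → M) p)
      ((Fin.snoc (fun i => &i) tZero : Fin (k + 1) → lang.Term (Empty ⊕ Fin k)) i)) =
      Fin.snoc p (zeroM M) := by
    ext i
    refine Fin.lastCases ?_ (fun i => ?_) i <;> simp
  have e2 : ∀ x : M, (fun i => Term.realize (Sum.elim (default : Empty → M)
      (Fin.snoc p x : Fin (k + 1) → M)) ((&i : lang.Term (Empty ⊕ Fin (k + 1))))) =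
      Fin.snoc p x := by
    intro x; ext i; simp
  have e3 : ∀ x : M, (fun i => Term.realize (Sum.elim (default : Empty → M)
      (Fin.snoc p x : Fin (k + 1) → M)) ((Fin.snoc (fun i => &(Fin.castSucc i))
        (tSucc (&(Fin.last k))) : Fin (k + 1) → lang.Term (Empty ⊕ Fin (k + 1))) i)) =
      Fin.snoc p (succM x) := by
    intro x; ext i
    refine Fin.lastCases ?_ (fun i => ?_) i <;> simp
  rw [e1] at this
  simp only [e2, e3, hP] at this
  exact this ⟨h0, h1⟩ x

/-! ### Arithmetic in a model of Peano arithmetic -/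

theorem realize_axQ (h : M ⊨ axiomsPA) {A : lang.Sentence} (hA : A ∈ axiomsQ) : M ⊨ A :=
  Theory.realize_sentence_of_mem (T := axiomsPA) (Set.mem_union_left _ hA)

theorem induction_one (h : M ⊨ axiomsPA) (φ : lang.Formula (Fin 1))
    (h0 : φ.Realize ![zeroM M]) (h1 : ∀ x : M, φ.Realize ![x] → φ.Realize ![succM x]) (x : M) :
    φ.Realize ![x] :=
  models_axiomsPA_induction h φ ![] h0 h1 x

theorem induction_two (h : M ⊨ axiomsPA) (φ : lang.Formula (Fin 2)) (y : M)
    (h0 : φ.Realize ![zeroM M, y]) (h1 : ∀ x : M, φ.Realize ![x, y] → φ.Realize ![succM x, y])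
    (x : M) : φ.Realize ![x, y] :=
  models_axiomsPA_induction h φ ![y] h0 h1 x

theorem induction_three (h : M ⊨ axiomsPA) (φ : lang.Formula (Fin 3)) (y z : M)
    (h0 : φ.Realize ![zeroM M, y, z])
    (h1 : ∀ x : M, φ.Realize ![x, y, z] → φ.Realize ![succM x, y, z])
    (x : M) : φ.Realize ![x, y, z] :=
  models_axiomsPA_induction h φ ![y, z] h0 h1 x

theorem succM_ne_zeroM (h : M ⊨ axiomsPA) (x : M) : succM x ≠ zeroM M := by
  have := realize_axQ h (A := axS0) (by simp [axiomsQ])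
  simp only [axS0, Sentence.Realize, Formula.Realize, BoundedFormula.realize_all,
    BoundedFormula.realize_not, BoundedFormula.realize_bdEqual, realize_tSucc, realize_tZero] at this
  simpa [Fin.snoc] using this x

theorem succM_injective (h : M ⊨ axiomsPA) {x y : M} (hxy : succM x = succM y) : x = y := by
  have := realize_axQ h (A := axS1) (by simp [axiomsQ])
  simp only [axS1, Sentence.Realize, Formula.Realize, BoundedFormula.realize_all,
    BoundedFormula.realize_imp, BoundedFormula.realize_bdEqual, realize_tSucc] at this
  have := this x y
  simp [Fin.snoc] at this
  exact this hxy

theorem eq_zeroM_or_succM (h : M ⊨ axiomsPA) (x : M) : x = zeroM M ∨ ∃ y, succM y = x := by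
  have := realize_axQ h (A := axS2) (by simp [axiomsQ])
  simp only [axS2, Sentence.Realize, Formula.Realize, BoundedFormula.realize_all,
    BoundedFormula.realize_sup, BoundedFormula.realize_ex,
    BoundedFormula.realize_bdEqual, realize_tSucc, realize_tZero] at this
  simpa [Fin.snoc] using this x

theorem addM_zeroM (h : M ⊨ axiomsPA) (x : M) : addM x (zeroM M) = x := by
  have := realize_axQ h (A := axA0) (by simp [axiomsQ])
  simp only [axA0, Sentence.Realize, Formula.Realize, BoundedFormula.realize_all,
    BoundedFormula.realize_bdEqual, realize_tAdd, realize_tZero] at this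
  simpa [Fin.snoc] using this x

theorem addM_succM (h : M ⊨ axiomsPA) (x y : M) : addM x (succM y) = succM (addM x y) := by
  have := realize_axQ h (A := axA1) (by simp [axiomsQ])
  simp only [axA1, Sentence.Realize, Formula.Realize, BoundedFormula.realize_all,
    BoundedFormula.realize_bdEqual, realize_tAdd, realize_tSucc] at this
  simpa [Fin.snoc] using this x y

theorem mulM_zeroM (h : M ⊨ axiomsPA) (x : M) : mulM x (zeroM M) = zeroM M := by
  have := realize_axQ h (A := axM0) (by simp [axiomsQ])
  simp only [axM0, Sentence.Realize, Formula.Realize, BoundedFormula.realize_all,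
    BoundedFormula.realize_bdEqual, realize_tMul, realize_tZero] at this
  simpa [Fin.snoc] using this x

theorem mulM_succM (h : M ⊨ axiomsPA) (x y : M) :
    mulM x (succM y) = addM x (mulM x y) := by
  have := realize_axQ h (A := axM1) (by simp [axiomsQ])
  simp only [axM1, Sentence.Realize, Formula.Realize, BoundedFormula.realize_all,
    BoundedFormula.realize_bdEqual, realize_tMul, realize_tAdd, realize_tSucc] at this
  simpa [Fin.snoc] using this x y

/-! ### Semiring laws, by induction. -/

theorem zeroM_addM (h : M ⊨ axiomsPA) (x : M) : addM (zeroM M) x = x := by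
  have := induction_one h ((tAdd tZero (Term.var 0)).equal (Term.var 0))
    (by simp [Formula.realize_equal, addM_zeroM h])
    (fun x => by simpa [Formula.realize_equal, addM_succM h] using congrArg succM) x
  simpa [Formula.realize_equal] using this

theorem succM_addM (h : M ⊨ axiomsPA) (x y : M) : addM (succM x) y = succM (addM x y) := by
  have := induction_two h ((tAdd (tSucc (Term.var 1)) (Term.var 0)).equal
      (tSucc (tAdd (Term.var 1) (Term.var 0)))) x
    (by simp [Formula.realize_equal, addM_zeroM h])
    (fun x => by simp +contextual [Formula.realize_equal, addM_succM h]) y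
  simpa [Formula.realize_equal] using this

theorem addM_comm (h : M ⊨ axiomsPA) (x y : M) : addM x y = addM y x := by
  have := induction_two h ((tAdd (Term.var 1) (Term.var 0)).equal
      (tAdd (Term.var 0) (Term.var 1))) x
    (by simp [Formula.realize_equal, addM_zeroM h, zeroM_addM h])
    (fun x => by simp +contextual [Formula.realize_equal, addM_succM h, succM_addM h]) y
  simpa [Formula.realize_equal] using this

theorem addM_assoc (h : M ⊨ axiomsPA) (x y z : M) :
    addM (addM x y) z = addM x (addM y z) := by
  have := induction_three h ((tAdd (tAdd (Term.var 1) (Term.var 2)) (Term.var 0)).equal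
      (tAdd (Term.var 1) (tAdd (Term.var 2) (Term.var 0)))) x y
    (by simp [Formula.realize_equal, addM_zeroM h])
    (fun x => by simp +contextual [Formula.realize_equal, addM_succM h]) z
  simpa [Formula.realize_equal] using this

theorem zeroM_mulM (h : M ⊨ axiomsPA) (x : M) : mulM (zeroM M) x = zeroM M := by
  have := induction_one h ((tMul tZero (Term.var 0)).equal tZero)
    (by simp [Formula.realize_equal, mulM_zeroM h])
    (fun x => by simp +contextual [Formula.realize_equal, mulM_succM h, zeroM_addM h]) x
  simpa [Formula.realize_equal] using this

theorem addM_left_comm (h : M ⊨ axiomsPA) (x y z : M) :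
    addM x (addM y z) = addM y (addM x z) := by
  rw [← addM_assoc h, addM_comm h x y, addM_assoc h]

theorem succM_mulM (h : M ⊨ axiomsPA) (x y : M) :
    mulM (succM x) y = addM y (mulM x y) := by
  have := induction_two h ((tMul (tSucc (Term.var 1)) (Term.var 0)).equal
      (tAdd (Term.var 0) (tMul (Term.var 1) (Term.var 0)))) x
    (by simp [Formula.realize_equal, addM_zeroM h, mulM_zeroM h])
    (fun y => by
      simp +contextual [Formula.realize_equal, mulM_succM h, succM_addM h,
        addM_left_comm h x]) y
  simpa [Formula.realize_equal] using this

theorem mulM_comm (h : M ⊨ axiomsPA) (x y : M) : mulM x y = mulM y x := by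
  have := induction_two h ((tMul (Term.var 1) (Term.var 0)).equal
      (tMul (Term.var 0) (Term.var 1))) x
    (by simp [Formula.realize_equal, mulM_zeroM h, zeroM_mulM h])
    (fun x => by simp +contextual [Formula.realize_equal, mulM_succM h, succM_mulM h]) y
  simpa [Formula.realize_equal] using this

theorem mulM_addM (h : M ⊨ axiomsPA) (x y z : M) :
    mulM x (addM y z) = addM (mulM x y) (mulM x z) := by
  have := induction_three h ((tMul (Term.var 1) (tAdd (Term.var 2) (Term.var 0))).equal
      (tAdd (tMul (Term.var 1) (Term.var 2)) (tMul (Term.var 1) (Term.var 0)))) x y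
    (by simp [Formula.realize_equal, mulM_zeroM h, addM_zeroM h])
    (fun z => by
      simp +contextual [Formula.realize_equal, mulM_succM h, addM_succM h,
        addM_left_comm h (mulM x y)]) z
  simpa [Formula.realize_equal] using this

theorem mulM_assoc (h : M ⊨ axiomsPA) (x y z : M) :
    mulM (mulM x y) z = mulM x (mulM y z) := by
  have := induction_three h ((tMul (tMul (Term.var 1) (Term.var 2)) (Term.var 0)).equal
      (tMul (Term.var 1) (tMul (Term.var 2) (Term.var 0)))) x y
    (by simp [Formula.realize_equal, mulM_zeroM h])
    (fun z => by simp +contextual [Formula.realize_equal, mulM_succM h, mulM_addM h]) z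
  simpa [Formula.realize_equal] using this

/-! ### Cancellation and comparability. -/

theorem addM_right_cancel (h : M ⊨ axiomsPA) (x y z : M) (hz : addM x z = addM y z) : x = y := by
  have := induction_three h (((tAdd (Term.var 1) (Term.var 0)).equal
      (tAdd (Term.var 2) (Term.var 0))).imp ((Term.var 1).equal (Term.var 2))) x y
    (by simp [Formula.realize_equal, Formula.realize_imp, addM_zeroM h])
    (fun z => by
      simp only [Formula.realize_equal, Formula.realize_imp, realize_tAdd, Term.realize_var,
        Matrix.cons_val, addM_succM h]
      exact fun h1 h2 => h1 (succM_injective h h2)) z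
  simp only [Formula.realize_equal, Formula.realize_imp, realize_tAdd, Term.realize_var,
        Matrix.cons_val] at this
  exact this hz

theorem addM_total (h : M ⊨ axiomsPA) (x y : M) :
    ∃ z, addM x z = y ∨ addM y z = x := by
  have := induction_two h (exF (((tAdd (Term.var 1) (Term.var 0)).equal (Term.var 2)) ⊔
      ((tAdd (Term.var 2) (Term.var 0)).equal (Term.var 1)))) y
    ?_ ?_ x
  · simpa [Formula.realize_sup, Formula.realize_equal] using this
  · simp only [realize_exF, Formula.realize_sup, Formula.realize_equal, realize_tAdd,
      Term.realize_var]
    exact ⟨y, Or.inl (zeroM_addM h y)⟩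
  · intro x
    simp only [realize_exF, Formula.realize_sup, Formula.realize_equal, realize_tAdd,
      Term.realize_var]
    rintro ⟨z, hz | hz⟩
    · change addM x z = y at hz
      -- If `x = y`, the comparison flips with difference 1 when `x` is increased; otherwise the
      -- difference drops by one.
      rcases eq_zeroM_or_succM h z with rfl | ⟨w, rfl⟩
      · refine ⟨succM (zeroM M), Or.inr ?_⟩
        change addM y (succM (zeroM M)) = succM x
        rw [addM_succM h, ← hz, addM_zeroM h, addM_zeroM h]
      · refine ⟨w, Or.inl ?_⟩
        change addM (succM x) w = y
        rw [← hz, succM_addM h, addM_succM h]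
    · change addM y z = x at hz
      refine ⟨succM z, Or.inr ?_⟩
      change addM y (succM z) = succM x
      rw [addM_succM h, hz]

theorem addM_eq_zeroM (h : M ⊨ axiomsPA) {x y : M} (hxy : addM x y = zeroM M) : y = zeroM M := by
  rcases eq_zeroM_or_succM h y with rfl | ⟨w, rfl⟩
  · rfl
  · rw [addM_succM h] at hxy
    exact (succM_ne_zeroM h _ hxy).elim

theorem mulM_ne_zeroM (h : M ⊨ axiomsPA) {x y : M} (hx : x ≠ zeroM M) (hy : y ≠ zeroM M) :
    mulM x y ≠ zeroM M := by
  rcases eq_zeroM_or_succM h y with rfl | ⟨w, rfl⟩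
  · exact (hy rfl).elim
  · rcases eq_zeroM_or_succM h x with rfl | ⟨u, rfl⟩
    · exact (hx rfl).elim
    · rw [mulM_succM h, succM_addM h]
      exact succM_ne_zeroM h _

end Raw

/-- Models of Peano arithmetic, as discretely ordered semirings with definable induction. -/
class PAModel (M : Type) [lang.Structure M] extends CommSemiring M, LinearOrder M,
    IsStrictOrderedRing M, CanonicallyOrderedAdd M where
  zeroM_eq : zeroM M = 0
  succM_eq : ∀ x : M, succM x = x + 1
  addM_eq : ∀ x y : M, addM x y = x + y
  mulM_eq : ∀ x y : M, mulM x y = x * y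
  add_one_le_iff' : ∀ x y : M, x + 1 ≤ y ↔ x < y
  induction : ∀ {k : ℕ} (φ : lang.Formula (Fin (k + 1))) (p : Fin k → M),
    φ.Realize (Fin.cons 0 p : Fin (k + 1) → M) →
    (∀ x, φ.Realize (Fin.cons x p : Fin (k + 1) → M) →
      φ.Realize (Fin.cons (x + 1) p : Fin (k + 1) → M)) →
    ∀ x, φ.Realize (Fin.cons x p : Fin (k + 1) → M)

open Classical in
/-- A model of the axioms of Peano arithmetic is a discretely ordered semiring. -/
@[reducible]
noncomputable def PAModel.ofModels {M : Type} [lang.Structure M] (h : M ⊨ axiomsPA) :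
    PAModel M :=
  letI : Zero M := ⟨zeroM M⟩
  letI : One M := ⟨succM (zeroM M)⟩
  letI : Add M := ⟨addM⟩
  letI : Mul M := ⟨mulM⟩
  letI semi : CommSemiring M :=
    { zero := zeroM M
      one := succM (zeroM M)
      add := addM
      mul := mulM
      nsmul := nsmulRec
      npow := npowRec
      add_assoc := addM_assoc h
      zero_add := zeroM_addM h
      add_zero := addM_zeroM h
      add_comm := addM_comm h
      mul_assoc := mulM_assoc h
      one_mul := fun x => by
        change mulM (succM (zeroM M)) x = x
        rw [succM_mulM h, zeroM_mulM h, addM_zeroM h]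
      mul_one := fun x => by
        change mulM x (succM (zeroM M)) = x
        rw [mulM_succM h, mulM_zeroM h, addM_zeroM h]
      left_distrib := mulM_addM h
      right_distrib := fun x y z => by
        change mulM (addM x y) z = addM (mulM x z) (mulM y z)
        rw [mulM_comm h, mulM_addM h, mulM_comm h x, mulM_comm h y]
      zero_mul := zeroM_mulM h
      mul_zero := mulM_zeroM h
      mul_comm := mulM_comm h }
  have zero_def : zeroM M = (0 : M) := rfl
  have one_def : succM (zeroM M) = (1 : M) := rfl
  have add_def : ∀ x y : M, addM x y = x + y := fun _ _ => rfl
  have mul_def : ∀ x y : M, mulM x y = x * y := fun _ _ => rfl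
  have succ_def : ∀ x : M, succM x = x + 1 := fun x => by
    rw [← add_def, ← one_def, addM_succM h, addM_zeroM h]
  have cancel : ∀ x y z : M, x + z = y + z → x = y := addM_right_cancel h
  have cancel' : ∀ x y z : M, x + y = x + z → y = z := fun x y z hxy =>
    cancel y z x (by rw [add_comm y, add_comm z, hxy])
  have eq_zero : ∀ {x y : M}, x + y = 0 → y = 0 := fun hxy => addM_eq_zeroM h hxy
  have ne_zero : ∀ {x y : M}, x ≠ 0 → y ≠ 0 → x * y ≠ 0 := fun hx hy => mulM_ne_zeroM h hx hy
  letI ord : LinearOrder M :=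
    { le := fun x y => ∃ z, x + z = y
      le_refl := fun x => ⟨0, add_zero x⟩
      le_trans := by
        rintro x _ _ ⟨a, rfl⟩ ⟨b, rfl⟩
        exact ⟨a + b, (add_assoc _ _ _).symm⟩
      le_antisymm := by
        rintro x _ ⟨a, rfl⟩ ⟨b, hb⟩
        have : a + b = 0 := cancel' x _ _ (by rw [← add_assoc, hb, add_zero])
        have hb0 := eq_zero this
        rw [hb0, add_zero] at this
        rw [this, add_zero]
      le_total := fun x y => by
        obtain ⟨z, hz | hz⟩ := addM_total h x y
        · exact Or.inl ⟨z, hz⟩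
        · exact Or.inr ⟨z, hz⟩
      toDecidableLE := Classical.decRel _ }
  have le_def : ∀ x y : M, x ≤ y ↔ ∃ z, x + z = y := fun _ _ => Iff.rfl
  have lt_def : ∀ x y : M, x < y ↔ ∃ z, z ≠ 0 ∧ x + z = y := fun x y => by
    rw [lt_iff_le_and_ne, le_def]
    constructor
    · rintro ⟨⟨z, rfl⟩, hz⟩
      exact ⟨z, fun h0 => hz (by rw [h0, add_zero]), rfl⟩
    · rintro ⟨z, hz, rfl⟩
      exact ⟨⟨z, rfl⟩, fun h0 => hz (cancel' x _ _ (by rw [← h0, add_zero]))⟩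
  have hpos : ∀ x : M, 0 < x ↔ x ≠ 0 := fun x => by
    rw [lt_def]
    constructor
    · rintro ⟨z, hz, rfl⟩
      rwa [zero_add]
    · exact fun hx => ⟨x, hx, zero_add x⟩
  have one_ne : (1 : M) ≠ 0 := succM_ne_zeroM h _
  have hmul : ∀ a : M, 0 < a → ∀ b c : M, b < c → a * b < a * c := by
    intro a ha b c hbc
    rw [lt_def] at hbc
    obtain ⟨z, hz, rfl⟩ := hbc
    rw [lt_def]
    exact ⟨a * z, ne_zero ((hpos a).1 ha) hz, (mul_add _ _ _).symm⟩
  { semi, ord with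
    add_le_add_left := by
      rintro x _ ⟨a, rfl⟩ z
      exact ⟨a, by rw [add_right_comm]⟩
    le_of_add_le_add_left := by
      rintro x y z ⟨a, ha⟩
      exact ⟨a, cancel' x _ _ (by rw [← ha, add_assoc])⟩
    zero_le_one := ⟨1, zero_add 1⟩
    exists_pair_ne := ⟨0, 1, one_ne.symm⟩
    mul_lt_mul_of_pos_left := fun a ha b c hbc => hmul a ha b c hbc
    mul_lt_mul_of_pos_right := fun a ha b c hbc => by
      rw [mul_comm b, mul_comm c]
      exact hmul a ha b c hbc
    exists_add_of_le := fun {x y} hxy => by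
      obtain ⟨z, hz⟩ := hxy
      exact ⟨z, hz.symm⟩
    le_self_add := fun x y => ⟨y, rfl⟩
    le_add_self := fun x y => ⟨y, add_comm _ _⟩
    zeroM_eq := zero_def
    succM_eq := succ_def
    addM_eq := add_def
    mulM_eq := mul_def
    add_one_le_iff' := fun x y => by
      rw [lt_def, le_def]
      constructor
      · rintro ⟨z, rfl⟩
        refine ⟨1 + z, fun h0 => one_ne (eq_zero (x := z) ?_), (add_assoc _ _ _).symm⟩
        rw [add_comm, h0]
      · rintro ⟨z, hz, rfl⟩
        rcases eq_zeroM_or_succM h z with rfl | ⟨w, rfl⟩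
        · exact (hz rfl).elim
        · exact ⟨w, by rw [succ_def, add_assoc, add_comm 1]⟩
    induction := fun φ p h0 h1 x => by
      refine models_axiomsPA_induction h φ p h0 (fun x hx => ?_) x
      rw [succ_def]
      exact h1 x hx }

instance : PAModel ℕ where
  zero_le_one := Nat.zero_le 1
  le_self_add := fun x y => Nat.le_add_right x y
  le_add_self := fun x y => Nat.le_add_left x y
  exists_add_of_le := fun h => exists_add_of_le h
  add_le_add_left := fun _ _ h c => Nat.add_le_add_right h c
  le_of_add_le_add_left := fun _ _ _ h => Nat.le_of_add_le_add_left h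
  mul_lt_mul_of_pos_left := fun _ ha _ _ h => Nat.mul_lt_mul_of_pos_left h ha
  mul_lt_mul_of_pos_right := fun _ ha _ _ h => Nat.mul_lt_mul_of_pos_right h ha
  exists_pair_ne := ⟨0, 1, Nat.zero_ne_one⟩
  zeroM_eq := rfl
  succM_eq := fun _ => rfl
  addM_eq := fun _ _ => rfl
  mulM_eq := fun _ _ => rfl
  add_one_le_iff' := fun _ _ => Nat.add_one_le_iff
  induction := fun _ _ h0 h1 x => Nat.rec h0 h1 x

/-! ### Uniformly definable predicates -/

/-- A term in `k` variables, evaluated in all models of Peano arithmetic. -/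
def DefT {k : ℕ} (t : ∀ (M : Type) [lang.Structure M] [PAModel M], (Fin k → M) → M) : Prop :=
  ∃ τ : lang.Term (Fin k), ∀ (M : Type) [lang.Structure M] [PAModel M] (v : Fin k → M),
    τ.realize v = t M v

/-- A predicate that is defined by the same formula in all models of Peano arithmetic. -/
def Def {k : ℕ} (P : ∀ (M : Type) [lang.Structure M] [PAModel M], (Fin k → M) → Prop) : Prop :=
  ∃ φ : lang.Formula (Fin k), ∀ (M : Type) [lang.Structure M] [PAModel M] (v : Fin k → M),
    φ.Realize v ↔ P M v

/-! ### Closure of definability under connectives, quantifiers and substitution. -/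

section Closure

variable {k : ℕ}

theorem DefT.var (i : Fin k) : DefT (fun _ _ _ v => v i) :=
  ⟨Term.var i, fun _ _ _ _ => rfl⟩

theorem DefT.zero : DefT (k := k) (fun _ _ _ _ => 0) :=
  ⟨tZero, fun _ _ _ _ => by rw [realize_tZero, PAModel.zeroM_eq]⟩

variable {t u : ∀ (M : Type) [lang.Structure M] [PAModel M], (Fin k → M) → M}
  {P Q : ∀ (M : Type) [lang.Structure M] [PAModel M], (Fin k → M) → Prop}

theorem DefT.add (ht : DefT t) (hu : DefT u) : DefT (fun M _ _ v => t M v + u M v) := by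
  obtain ⟨τ, hτ⟩ := ht
  obtain ⟨υ, hυ⟩ := hu
  exact ⟨tAdd τ υ, fun M _ _ v => by rw [realize_tAdd, PAModel.addM_eq, hτ, hυ]⟩

theorem DefT.mul (ht : DefT t) (hu : DefT u) : DefT (fun M _ _ v => t M v * u M v) := by
  obtain ⟨τ, hτ⟩ := ht
  obtain ⟨υ, hυ⟩ := hu
  exact ⟨tMul τ υ, fun M _ _ v => by rw [realize_tMul, PAModel.mulM_eq, hτ, hυ]⟩

theorem realize_numeral {M : Type} [lang.Structure M] [PAModel M] {α : Type} (n : ℕ) (v : α → M) :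
    (numeral n : lang.Term α).realize v = (n : M) := by
  induction n with
  | zero => rw [numeral, realize_tZero, PAModel.zeroM_eq, Nat.cast_zero]
  | succ n ih => rw [numeral, realize_tSucc, PAModel.succM_eq, ih, Nat.cast_succ]

theorem DefT.cast (n : ℕ) : DefT (k := k) (fun _ _ _ _ => (n : _)) :=
  ⟨numeral n, fun _ _ _ _ => realize_numeral n _⟩

theorem DefT.one : DefT (k := k) (fun _ _ _ _ => 1) := by
  simpa using DefT.cast (k := k) 1

theorem Def.eq (ht : DefT t) (hu : DefT u) : Def (fun M _ _ v => t M v = u M v) := by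
  obtain ⟨τ, hτ⟩ := ht
  obtain ⟨υ, hυ⟩ := hu
  exact ⟨τ.equal υ, fun M _ _ v => by rw [Formula.realize_equal, hτ, hυ]⟩

theorem Def.not (hP : Def P) : Def (fun M _ _ v => ¬ P M v) := by
  obtain ⟨φ, hφ⟩ := hP
  exact ⟨φ.not, fun M _ _ v => by rw [Formula.realize_not, hφ]⟩

theorem Def.imp (hP : Def P) (hQ : Def Q) : Def (fun M _ _ v => P M v → Q M v) := by
  obtain ⟨φ, hφ⟩ := hP
  obtain ⟨ψ, hψ⟩ := hQ
  exact ⟨φ.imp ψ, fun M _ _ v => by rw [Formula.realize_imp, hφ, hψ]⟩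

theorem Def.congr (hP : Def P)
    (h : ∀ (M : Type) [lang.Structure M] [PAModel M] (v : Fin k → M), Q M v ↔ P M v) : Def Q := by
  obtain ⟨φ, hφ⟩ := hP
  exact ⟨φ, fun M _ _ v => by rw [hφ, h]⟩

theorem Def.and (hP : Def P) (hQ : Def Q) : Def (fun M _ _ v => P M v ∧ Q M v) :=
  (hP.imp hQ.not).not.congr fun M _ _ v => by tauto

theorem Def.or (hP : Def P) (hQ : Def Q) : Def (fun M _ _ v => P M v ∨ Q M v) :=
  (hP.not.imp hQ).congr fun M _ _ v => by tauto

theorem Def.iff (hP : Def P) (hQ : Def Q) : Def (fun M _ _ v => P M v ↔ Q M v) :=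
  ((hP.imp hQ).and (hQ.imp hP)).congr fun M _ _ v => by tauto

theorem Def.ex {P : ∀ (M : Type) [lang.Structure M] [PAModel M], (Fin k → M) → M → Prop}
    (hP : Def (k := k + 1) (fun M _ _ w => P M (Fin.tail w) (w 0))) :
    Def (fun M _ _ v => ∃ x, P M v x) := by
  obtain ⟨φ, hφ⟩ := hP
  exact ⟨exF φ, fun M _ _ v => by simp [hφ]⟩

theorem Def.all {P : ∀ (M : Type) [lang.Structure M] [PAModel M], (Fin k → M) → M → Prop}
    (hP : Def (k := k + 1) (fun M _ _ w => P M (Fin.tail w) (w 0))) :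
    Def (fun M _ _ v => ∀ x, P M v x) :=
  (Def.ex (P := fun M _ _ v x => ¬ P M v x) hP.not).not.congr fun _ _ _ _ => by
    simp

theorem Def.subst {n : ℕ}
    {P : ∀ (M : Type) [lang.Structure M] [PAModel M], (Fin n → M) → Prop} (hP : Def P)
    {σ : Fin n → ∀ (M : Type) [lang.Structure M] [PAModel M], (Fin k → M) → M}
    (hσ : ∀ i, DefT (σ i)) : Def (fun M _ _ v => P M (fun i => σ i M v)) := by
  obtain ⟨φ, hφ⟩ := hP
  choose τ hτ using hσ
  refine ⟨BoundedFormula.subst φ τ, fun M _ _ v => ?_⟩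
  rw [Formula.Realize, BoundedFormula.realize_subst, ← Formula.Realize, hφ]
  simp only [hτ]

theorem DefT.tail (ht : DefT t) : DefT (k := k + 1) (fun M _ _ w => t M (Fin.tail w)) := by
  obtain ⟨τ, hτ⟩ := ht
  refine ⟨τ.relabel Fin.succ, fun M _ _ v => ?_⟩
  beta_reduce
  rw [Term.realize_relabel, ← hτ]
  rfl

theorem lt_iff_exists_add_one {M : Type} [lang.Structure M] [PAModel M] (x y : M) :
    x < y ↔ ∃ z, x + 1 + z = y := by
  rw [← PAModel.add_one_le_iff', le_iff_exists_add]
  simp only [eq_comm]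

theorem lt_add_one_iff' {M : Type} [lang.Structure M] [PAModel M] (x y : M) :
    x < y + 1 ↔ x ≤ y := by
  rw [← PAModel.add_one_le_iff']
  exact add_le_add_iff_right 1

theorem Def.lt (ht : DefT t) (hu : DefT u) : Def (fun M _ _ v => t M v < u M v) :=
  (Def.ex (P := fun M _ _ v z => t M v + 1 + z = u M v)
    (.eq (.add (.add ht.tail .one) (.var 0)) hu.tail)).congr
      fun _ _ _ _ => lt_iff_exists_add_one _ _

/-! ### The standard numbers are an initial segment -/

theorem realize_natCast {M : Type} [lang.Structure M] [PAModel M] {α : Type} (τ : lang.Term α)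
    (v : α → ℕ) : τ.realize (fun i => ((v i : ℕ) : M)) = ((τ.realize v : ℕ) : M) := by
  induction τ with
  | var i => rfl
  | func f ts ih =>
    cases f with
    | zero =>
      have e : Term.func (L := lang) Func.zero ts = (tZero : lang.Term α) := by
        unfold tZero; congr 1; exact Subsingleton.elim _ _
      rw [e, realize_tZero, realize_tZero, PAModel.zeroM_eq, PAModel.zeroM_eq, Nat.cast_zero]
    | succ =>
      have e : Term.func (L := lang) Func.succ ts = tSucc (ts 0) := by
        unfold tSucc; congr 1; ext i; fin_cases i; rfl
      rw [e, realize_tSucc, realize_tSucc, ih, PAModel.succM_eq, PAModel.succM_eq, Nat.cast_add,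
        Nat.cast_one]
    | add =>
      have e : Term.func (L := lang) Func.add ts = tAdd (ts 0) (ts 1) := by
        unfold tAdd; congr 1; ext i; fin_cases i <;> rfl
      rw [e, realize_tAdd, realize_tAdd, ih, ih, PAModel.addM_eq, PAModel.addM_eq, Nat.cast_add]
    | mul =>
      have e : Term.func (L := lang) Func.mul ts = tMul (ts 0) (ts 1) := by
        unfold tMul; congr 1; ext i; fin_cases i <;> rfl
      rw [e, realize_tMul, realize_tMul, ih, ih, PAModel.mulM_eq, PAModel.mulM_eq, Nat.cast_mul]

/-- Discreteness of the order drives the induction: `x < n + 1` means `x ≤ n`. This fact is what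
makes bounded quantifiers absolute. -/
theorem lt_natCast_iff {M : Type} [lang.Structure M] [PAModel M] {x : M} {n : ℕ} :
    x < (n : M) ↔ ∃ m < n, x = (m : M) := by
  constructor
  · induction n with
    | zero => intro hx; exact absurd hx (by simp)
    | succ n ih =>
      intro hx
      rw [Nat.cast_succ, lt_add_one_iff', le_iff_eq_or_lt] at hx
      rcases hx with rfl | hx
      · exact ⟨n, Nat.lt_succ_self n, rfl⟩
      · obtain ⟨m, hm, rfl⟩ := ih hx
        exact ⟨m, Nat.lt_succ_of_lt hm, rfl⟩
  · rintro ⟨m, hm, rfl⟩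
    exact Nat.cast_lt.2 hm

/-! ### Absolute predicates -/

/-- A definable predicate that does not change its meaning for standard arguments. -/
def Abs (P : ∀ (M : Type) [lang.Structure M] [PAModel M], (Fin k → M) → Prop) : Prop :=
  Def P ∧ ∀ (M : Type) [lang.Structure M] [PAModel M] (v : Fin k → ℕ),
    P M (fun i => ((v i : ℕ) : M)) ↔ P ℕ v

theorem DefT.natCast (ht : DefT t) {M : Type} [lang.Structure M] [PAModel M] (v : Fin k → ℕ) :
    t M (fun i => ((v i : ℕ) : M)) = ((t ℕ v : ℕ) : M) := by
  obtain ⟨τ, hτ⟩ := ht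
  rw [← hτ, ← hτ, realize_natCast]

theorem Abs.eq (ht : DefT t) (hu : DefT u) : Abs (fun M _ _ v => t M v = u M v) :=
  ⟨.eq ht hu, fun M _ _ v => by beta_reduce; rw [ht.natCast, hu.natCast, Nat.cast_inj]⟩

theorem Abs.lt (ht : DefT t) (hu : DefT u) : Abs (fun M _ _ v => t M v < u M v) :=
  ⟨.lt ht hu, fun M _ _ v => by beta_reduce; rw [ht.natCast, hu.natCast, Nat.cast_lt]⟩

theorem Abs.not (hP : Abs P) : Abs (fun M _ _ v => ¬ P M v) :=
  ⟨hP.1.not, fun M _ _ v => by beta_reduce; rw [hP.2]⟩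

theorem Abs.and (hP : Abs P) (hQ : Abs Q) : Abs (fun M _ _ v => P M v ∧ Q M v) :=
  ⟨hP.1.and hQ.1, fun M _ _ v => by beta_reduce; rw [hP.2, hQ.2]⟩

theorem Abs.or (hP : Abs P) (hQ : Abs Q) : Abs (fun M _ _ v => P M v ∨ Q M v) :=
  ⟨hP.1.or hQ.1, fun M _ _ v => by beta_reduce; rw [hP.2, hQ.2]⟩

theorem Abs.congr (hP : Abs P)
    (h : ∀ (M : Type) [lang.Structure M] [PAModel M] (v : Fin k → M), Q M v ↔ P M v) : Abs Q :=
  ⟨hP.1.congr h, fun M _ _ v => by rw [h, h, hP.2]⟩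

theorem cons_natCast {M : Type} [lang.Structure M] [PAModel M] (m : ℕ) (v : Fin k → ℕ) :
    (Fin.cons (m : M) (fun i => ((v i : ℕ) : M)) : Fin (k + 1) → M) =
      fun i => (((Fin.cons m v : Fin (k + 1) → ℕ) i : ℕ) : M) := by
  ext i
  refine Fin.cases ?_ (fun i => ?_) i <;> simp

/-- For standard arguments the bound is standard, and only standard numbers lie below it, so the
quantifier has the same range in `M` as in `ℕ`. -/
theorem Abs.bex {P : ∀ (M : Type) [lang.Structure M] [PAModel M], (Fin k → M) → M → Prop}
    (ht : DefT t) (hP : Abs (k := k + 1) (fun M _ _ w => P M (Fin.tail w) (w 0))) :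
    Abs (fun M _ _ v => ∃ x < t M v, P M v x) := by
  refine ⟨Def.ex (.and (.lt (.var 0) ht.tail) hP.1), fun M _ _ v => ?_⟩
  beta_reduce
  rw [ht.natCast]
  have key : ∀ m : ℕ, P M (fun i => ((v i : ℕ) : M)) (m : M) ↔ P ℕ v m := fun m => by
    have := hP.2 M (Fin.cons m v : Fin (k + 1) → ℕ)
    rw [← cons_natCast] at this
    simpa using this
  constructor
  · rintro ⟨x, hx, hp⟩
    obtain ⟨m, hm, rfl⟩ := lt_natCast_iff.1 hx
    exact ⟨m, hm, (key m).1 hp⟩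
  · rintro ⟨m, hm, hp⟩
    exact ⟨m, Nat.cast_lt.2 hm, (key m).2 hp⟩

theorem Abs.ball {P : ∀ (M : Type) [lang.Structure M] [PAModel M], (Fin k → M) → M → Prop}
    (ht : DefT t) (hP : Abs (k := k + 1) (fun M _ _ w => P M (Fin.tail w) (w 0))) :
    Abs (fun M _ _ v => ∀ x < t M v, P M v x) :=
  (Abs.bex (P := fun M _ _ v x => ¬ P M v x) ht hP.not).not.congr fun _ _ _ _ => by
    simp

theorem Abs.subst {n : ℕ}
    {P : ∀ (M : Type) [lang.Structure M] [PAModel M], (Fin n → M) → Prop} (hP : Abs P)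
    {σ : Fin n → ∀ (M : Type) [lang.Structure M] [PAModel M], (Fin k → M) → M}
    (hσ : ∀ i, DefT (σ i)) : Abs (fun M _ _ v => P M (fun i => σ i M v)) :=
  ⟨hP.1.subst hσ, fun M _ _ v => by
    simp only [(hσ _).natCast]
    exact hP.2 M _⟩

theorem Abs.reindex {n : ℕ}
    {P : ∀ (M : Type) [lang.Structure M] [PAModel M], (Fin n → M) → Prop} (hP : Abs P)
    (σ : Fin n → Fin k) : Abs (fun M _ _ v => P M (fun i => v (σ i))) :=
  hP.subst (σ := fun i _ _ _ v => v (σ i)) fun i => .var (σ i)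

end Closure

/-! ### Σ₁ relations on the natural numbers -/

/-- A relation on `ℕ` of the form `∃ w, δ(w, v)` with an absolute predicate `δ`. -/
def Sigma1 {k : ℕ} (R : (Fin k → ℕ) → Prop) : Prop :=
  ∃ δ : ∀ (M : Type) [lang.Structure M] [PAModel M], (Fin (k + 1) → M) → Prop,
    Abs δ ∧ ∀ v, R v ↔ ∃ w, δ ℕ (Fin.cons w v)

/-- A function on `ℕ` that is given by a term. -/
def PolyT {k : ℕ} (t : (Fin k → ℕ) → ℕ) : Prop :=
  ∃ τ : lang.Term (Fin k), ∀ v, τ.realize v = t v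

/-! ### Closure properties of Σ₁ relations. -/

section Sigma1

variable {k : ℕ} {t u : (Fin k → ℕ) → ℕ} {P Q : (Fin k → ℕ) → Prop}

theorem PolyT.var (i : Fin k) : PolyT (fun v => v i) := ⟨Term.var i, fun _ => rfl⟩

theorem PolyT.const (n : ℕ) : PolyT (k := k) (fun _ => n) :=
  ⟨numeral n, fun v => by rw [realize_numeral, Nat.cast_id]⟩

theorem PolyT.add (ht : PolyT t) (hu : PolyT u) : PolyT (fun v => t v + u v) := by
  obtain ⟨τ, hτ⟩ := ht
  obtain ⟨υ, hυ⟩ := hu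
  exact ⟨tAdd τ υ, fun v => by rw [realize_tAdd, PAModel.addM_eq, hτ, hυ]⟩

theorem PolyT.mul (ht : PolyT t) (hu : PolyT u) : PolyT (fun v => t v * u v) := by
  obtain ⟨τ, hτ⟩ := ht
  obtain ⟨υ, hυ⟩ := hu
  exact ⟨tMul τ υ, fun v => by rw [realize_tMul, PAModel.mulM_eq, hτ, hυ]⟩

theorem PolyT.exists_defT (ht : PolyT t) :
    ∃ t' : ∀ (M : Type) [lang.Structure M] [PAModel M], (Fin k → M) → M,
      DefT t' ∧ ∀ v, t' ℕ v = t v := by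
  obtain ⟨τ, hτ⟩ := ht
  exact ⟨fun M _ _ v => τ.realize v, ⟨τ, fun _ _ _ _ => rfl⟩, hτ⟩

theorem Sigma1.of_abs {R : ∀ (M : Type) [lang.Structure M] [PAModel M], (Fin k → M) → Prop}
    (hR : Abs R) : Sigma1 (R ℕ) :=
  ⟨fun M _ _ w => R M (Fin.tail w), hR.reindex Fin.succ, fun v => by simp⟩

theorem Sigma1.congr (hP : Sigma1 P) (h : ∀ v, Q v ↔ P v) : Sigma1 Q := by
  obtain ⟨δ, hδ, hd⟩ := hP
  exact ⟨δ, hδ, fun v => by rw [h, hd]⟩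

theorem Sigma1.eq (ht : PolyT t) (hu : PolyT u) : Sigma1 (fun v => t v = u v) := by
  obtain ⟨t', ht', et⟩ := ht.exists_defT
  obtain ⟨u', hu', eu⟩ := hu.exists_defT
  exact (Sigma1.of_abs (Abs.eq ht' hu')).congr fun v => by rw [et, eu]

theorem Sigma1.lt (ht : PolyT t) (hu : PolyT u) : Sigma1 (fun v => t v < u v) := by
  obtain ⟨t', ht', et⟩ := ht.exists_defT
  obtain ⟨u', hu', eu⟩ := hu.exists_defT
  exact (Sigma1.of_abs (Abs.lt ht' hu')).congr fun v => by rw [et, eu]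

theorem Sigma1.le (ht : PolyT t) (hu : PolyT u) : Sigma1 (fun v => t v ≤ u v) :=
  (Sigma1.lt ht (hu.add (.const 1))).congr fun _ => Nat.lt_succ_iff.symm

theorem Sigma1.ex {P : (Fin k → ℕ) → ℕ → Prop}
    (hP : Sigma1 (k := k + 1) (fun w => P (Fin.tail w) (w 0))) :
    Sigma1 (fun v => ∃ x, P v x) := by
  obtain ⟨δ, hδ, hd⟩ := hP
  -- The new witness is a strict bound for both `x` and the old witness. Two unbounded quantifiers
  -- become one, and the matrix remains absolute.
  refine ⟨fun M _ _ w => ∃ x < w 0, ∃ y < w 0, δ M (Fin.cons y (Fin.cons x (Fin.tail w))),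
    Abs.bex (.var 0) (Abs.bex (.var 1)
      ((hδ.reindex (Fin.cons 0 (Fin.cons 1 (fun i : Fin k => i.succ.succ.succ)))).congr
        fun M _ _ v => ?_)), fun v => ?_⟩
  · refine iff_of_eq (congrArg _ (funext fun i => ?_))
    refine Fin.cases ?_ (fun i => ?_) i
    · simp
    · refine Fin.cases ?_ (fun i => ?_) i
      · simp [Fin.tail]
      · simp [Fin.tail]
  · have key : ∀ x, P v x ↔ ∃ w, δ ℕ (Fin.cons w (Fin.cons x v)) := fun x => by
      rw [← hd]; simp
    simp only [key, Fin.cons_zero, Fin.tail_cons]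
    constructor
    · rintro ⟨x, y, hy⟩
      exact ⟨x + y + 1, x, by omega, y, by omega, hy⟩
    · rintro ⟨_, x, _, y, _, hy⟩
      exact ⟨x, y, hy⟩

/-- Collection, needed only in `ℕ`: finitely many witnesses have a common bound. -/
theorem Sigma1.ball {P : (Fin k → ℕ) → ℕ → Prop} (ht : PolyT t)
    (hP : Sigma1 (k := k + 1) (fun w => P (Fin.tail w) (w 0))) :
    Sigma1 (fun v => ∀ x < t v, P v x) := by
  obtain ⟨δ, hδ, hd⟩ := hP
  obtain ⟨t', ht', et⟩ := ht.exists_defT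
  refine ⟨fun M _ _ w => ∀ x < t' M (Fin.tail w), ∃ y < w 0,
      δ M (Fin.cons y (Fin.cons x (Fin.tail w))),
    Abs.ball ht'.tail (Abs.bex (.var 1)
      ((hδ.reindex (Fin.cons 0 (Fin.cons 1 (fun i : Fin k => i.succ.succ.succ)))).congr
        fun M _ _ v => ?_)), fun v => ?_⟩
  · refine iff_of_eq (congrArg _ (funext fun i => ?_))
    refine Fin.cases ?_ (fun i => ?_) i
    · simp
    · refine Fin.cases ?_ (fun i => ?_) i
      · simp [Fin.tail]
      · simp [Fin.tail]
  · have key : ∀ x, P v x ↔ ∃ w, δ ℕ (Fin.cons w (Fin.cons x v)) := fun x => by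
      rw [← hd]; simp
    simp only [key, Fin.cons_zero, Fin.tail_cons, et]
    constructor
    · intro h
      choose! w hw using h
      refine ⟨(Finset.range (t v)).sup w + 1, fun x hx => ⟨w x, ?_, hw x hx⟩⟩
      exact Nat.lt_succ_of_le (Finset.le_sup (f := w) (Finset.mem_range.2 hx))
    · rintro ⟨W, hW⟩ x hx
      obtain ⟨y, _, hy⟩ := hW x hx
      exact ⟨y, hy⟩

theorem Sigma1.subst {n : ℕ} {R : (Fin n → ℕ) → Prop} (hR : Sigma1 R)
    {σ : Fin n → (Fin k → ℕ) → ℕ} (hσ : ∀ i, PolyT (σ i)) :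
    Sigma1 (fun v => R (fun i => σ i v)) := by
  obtain ⟨δ, hδ, hd⟩ := hR
  choose σ' hσ' eσ using fun i => (hσ i).exists_defT
  refine ⟨fun M _ _ w => δ M (Fin.cons (w 0) (fun i => σ' i M (Fin.tail w))),
    (hδ.subst (k := k + 1) (σ := Fin.cons (fun M _ _ w => w 0)
      (fun i M _ _ w => σ' i M (Fin.tail w))) ?_).congr fun M _ _ v => ?_, fun v => ?_⟩
  · intro i
    refine Fin.cases ?_ (fun i => ?_) i
    · exact .var 0
    · exact (hσ' i).tail
  · refine iff_of_eq (congrArg _ (funext fun i => ?_))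
    refine Fin.cases ?_ (fun i => ?_) i <;> simp
  · beta_reduce
    rw [hd]
    simp [eσ]

theorem Sigma1.and (hP : Sigma1 P) (hQ : Sigma1 Q) : Sigma1 (fun v => P v ∧ Q v) := by
  obtain ⟨δ, hδ, hd⟩ := hP
  obtain ⟨ε, hε, he⟩ := hQ
  have h : Sigma1 (fun v : Fin k → ℕ => ∃ x y, δ ℕ (Fin.cons x v) ∧ ε ℕ (Fin.cons y v)) := by
    refine Sigma1.ex (Sigma1.ex ((Sigma1.of_abs (Abs.and
      (hδ.reindex (Fin.cons 1 (fun i : Fin k => i.succ.succ)))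
      (hε.reindex (Fin.cons 0 (fun i : Fin k => i.succ.succ))))).congr fun v => ?_))
    refine and_congr (iff_of_eq (congrArg _ (funext fun i => ?_)))
      (iff_of_eq (congrArg _ (funext fun i => ?_))) <;>
    refine Fin.cases ?_ (fun i => ?_) i <;> simp [Fin.tail]
  exact h.congr fun v => by rw [hd, he]; simp

theorem Sigma1.or (hP : Sigma1 P) (hQ : Sigma1 Q) : Sigma1 (fun v => P v ∨ Q v) := by
  obtain ⟨δ, hδ, hd⟩ := hP
  obtain ⟨ε, hε, he⟩ := hQ
  exact ⟨fun M _ _ w => δ M w ∨ ε M w, hδ.or hε, fun v => by rw [exists_or, ← hd, ← he]⟩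

/-- The absolute matrix of a Σ₁ relation defines, in every model, a predicate that holds for all
standard arguments for which the relation holds. -/
theorem Sigma1.exists_upward (hP : Sigma1 P) :
    ∃ P' : ∀ (M : Type) [lang.Structure M] [PAModel M], (Fin k → M) → Prop,
      Def P' ∧ (∀ v, P' ℕ v ↔ P v) ∧
      ∀ (M : Type) [lang.Structure M] [PAModel M] (v : Fin k → ℕ),
        P v → P' M (fun i => ((v i : ℕ) : M)) := by
  obtain ⟨δ, hδ, hd⟩ := hP
  refine ⟨fun M _ _ v => ∃ w, δ M (Fin.cons w v), Def.ex ?_, fun v => (hd v).symm,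
    fun M _ _ v hv => ?_⟩
  · exact hδ.1.congr fun M _ _ v => by simp
  · obtain ⟨w, hw⟩ := (hd v).1 hv
    refine ⟨(w : M), ?_⟩
    rw [cons_natCast]
    exact (hδ.2 M _).2 hw

end Sigma1

/-! ### Functions with a Σ₁ graph are representable -/

/-- The Σ₁ definition alone could have spurious values with nonstandard witnesses. The formula
therefore asks for a least bound `u` on a pair of value and witness, with `y` and its witness below
`u`. A standard bound `u₀` exists and is seen in every model, so `u ≤ u₀`; then value and witness
are standard and the matrix can be read in `ℕ`. -/
theorem exists_formula_graph {k : ℕ} {f : (Fin k → ℕ) → ℕ}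
    (hf : Sigma1 (k := k + 1) (fun w => w 0 = f (Fin.tail w))) :
    ∃ F : lang.Formula (Fin (k + 1)), ∀ (M : Type) [lang.Structure M] [PAModel M]
      (x : Fin k → ℕ) (y : M),
      F.Realize (Fin.snoc (fun i => ((x i : ℕ) : M)) y : Fin (k + 1) → M) ↔
        y = ((f x : ℕ) : M) := by
  obtain ⟨δ, hδ, hd⟩ := hf
  have hB : Abs (k := k + 1) (fun M _ _ v => ∃ y < v 0, ∃ w < v 0,
      δ M (Fin.cons w (Fin.cons y (Fin.tail v)))) := by
    refine Abs.bex (.var 0) (Abs.bex (.var 1)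
      ((hδ.reindex (Fin.cons 0 (Fin.cons 1 (fun i : Fin k => i.succ.succ.succ)))).congr
        fun M _ _ v => iff_of_eq (congrArg _ (funext fun i => ?_))))
    refine Fin.cases ?_ (fun i => Fin.cases ?_ (fun i => ?_) i) i <;> simp [Fin.tail]
  have hG : Def (k := k + 1) (fun M _ _ v => ∃ u, (v 0 < u ∧ ∃ w < u, δ M (Fin.cons w v)) ∧
      ∀ u' < u, ¬ ∃ y < u', ∃ w < u', δ M (Fin.cons w (Fin.cons y (Fin.tail v)))) := by
    refine Def.ex (.and (.and (.lt (.var 1) (.var 0)) (Def.ex (.and (.lt (.var 0) (.var 1)) ?_)))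
      (Def.all (.imp (.lt (.var 0) (.var 1)) (.not ?_))))
    · refine (hδ.reindex (Fin.cons 0 (fun i : Fin (k + 1) => i.succ.succ))).1.congr
        fun M _ _ v => iff_of_eq (congrArg _ (funext fun i => ?_))
      refine Fin.cases ?_ (fun i => ?_) i <;> simp [Fin.tail]
    · refine (hB.reindex (Fin.cons 0 (fun i : Fin k => i.succ.succ.succ))).1.congr
        fun M _ _ v => ?_
      simp only [Fin.cons_zero]
      exact Iff.rfl
  obtain ⟨φ, hφ⟩ := hG
  refine ⟨φ.relabel (Fin.cons (Fin.last k) Fin.castSucc : Fin (k + 1) → Fin (k + 1)),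
    fun M _ _ x y => ?_⟩
  rw [Formula.realize_relabel, snoc_comp_cons, hφ]
  simp only [Fin.cons_zero, Fin.tail_cons]
  have hB' : ∀ u : ℕ, (∃ y < (u : M), ∃ w < (u : M),
      δ M (Fin.cons w (Fin.cons y (fun i => ((x i : ℕ) : M))))) ↔
      ∃ y < u, ∃ w < u, δ ℕ (Fin.cons w (Fin.cons y x)) := fun u => by
    have := hB.2 M (Fin.cons u x)
    rw [← cons_natCast] at this
    simpa using this
  have hval : ∀ w y : ℕ, δ M (Fin.cons (w : M) (Fin.cons (y : M) (fun i => ((x i : ℕ) : M)))) ↔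
      δ ℕ (Fin.cons w (Fin.cons y x)) := fun w y => by
    rw [cons_natCast, cons_natCast]
    exact hδ.2 M _
  have hgraph : ∀ w y : ℕ, δ ℕ (Fin.cons w (Fin.cons y x)) → y = f x := fun w y h => by
    have := (hd (Fin.cons y x)).2 ⟨w, h⟩
    simpa using this
  have hex : ∃ u : ℕ, ∃ y < u, ∃ w < u, δ ℕ (Fin.cons w (Fin.cons y x)) := by
    obtain ⟨w, hw⟩ := (hd (Fin.cons (f x) x)).1 (by simp)
    exact ⟨f x + w + 1, f x, by omega, w, by omega, hw⟩
  classical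
  let u₀ := Nat.find hex
  have hu₀ : ∃ y < u₀, ∃ w < u₀, δ ℕ (Fin.cons w (Fin.cons y x)) := Nat.find_spec hex
  have hmin : ∀ u < u₀, ¬ ∃ y < u, ∃ w < u, δ ℕ (Fin.cons w (Fin.cons y x)) :=
    fun u hu => Nat.find_min hex hu
  constructor
  · rintro ⟨u, ⟨hyu, w, hwu, hw⟩, hu⟩
    -- Were `u₀` below `u`, it would contradict the minimality clause, because having a pair below
    -- `u₀` is absolute.
    have hle : u ≤ (u₀ : M) := by
      by_contra hlt
      exact hu _ (not_le.1 hlt) ((hB' u₀).2 hu₀)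
    obtain ⟨y, -, rfl⟩ := lt_natCast_iff.1 (hyu.trans_le hle)
    obtain ⟨w, -, rfl⟩ := lt_natCast_iff.1 (hwu.trans_le hle)
    rw [hgraph w y ((hval w y).1 hw)]
  · rintro rfl
    obtain ⟨y, hy, w, hwu, hw⟩ := hu₀
    obtain rfl := hgraph w y hw
    refine ⟨u₀, ⟨Nat.cast_lt.2 hy, w, Nat.cast_lt.2 hwu, (hval _ _).2 hw⟩, fun u hu => ?_⟩
    obtain ⟨u, hu', rfl⟩ := lt_natCast_iff.1 hu
    rw [hB']
    exact hmin u hu'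

/-! ### Theories that extend Peano arithmetic -/

theorem models_axiomsPA {T : lang.Theory} (hPA : PA ⊆ T) {M : Type} [lang.Structure M]
    (h : M ⊨ T) : M ⊨ axiomsPA := by
  rw [Theory.model_iff]
  intro A hA
  exact h.realize_of_mem A (hPA (Theory.models_sentence_of_mem hA))

/-- As `⊨ᵇ` is consequence over all models, no proof calculus is needed: every membership in `T`
below is reduced to an argument inside an arbitrary model. -/
theorem mem_of_forall_models {T : lang.Theory} (hT : IsTheory T) (hPA : PA ⊆ T)
    {A : lang.Sentence}
    (h : ∀ (M : Type) [lang.Structure M] [PAModel M], M ⊨ T → M ⊨ A) : A ∈ T := by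
  refine hT A (Theory.models_sentence_iff.2 fun M => ?_)
  let _ := PAModel.ofModels (models_axiomsPA hPA (M := M) M.is_model)
  exact h M M.is_model

/-! ### Partial recursive functions have Σ₁ graphs -/

section

variable {k : ℕ} {s t u : (Fin k → ℕ) → ℕ}

theorem Sigma1.comp₁ (R : ℕ → Prop) (hR : Sigma1 (k := 1) (fun v => R (v 0)))
    (hs : PolyT s) : Sigma1 (fun v => R (s v)) :=
  hR.subst (σ := ![s]) fun i => by fin_cases i; exact hs

theorem Sigma1.comp₂ (R : ℕ → ℕ → Prop) (hR : Sigma1 (k := 2) (fun v => R (v 0) (v 1)))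
    (hs : PolyT s) (ht : PolyT t) : Sigma1 (fun v => R (s v) (t v)) :=
  hR.subst (σ := ![s, t]) fun i => by fin_cases i <;> assumption

theorem Sigma1.comp₃ (R : ℕ → ℕ → ℕ → Prop)
    (hR : Sigma1 (k := 3) (fun v => R (v 0) (v 1) (v 2)))
    (hs : PolyT s) (ht : PolyT t) (hu : PolyT u) : Sigma1 (fun v => R (s v) (t v) (u v)) :=
  hR.subst (σ := ![s, t, u]) fun i => by fin_cases i <;> assumption

theorem sigma1_pair : Sigma1 (k := 3) (fun v => Nat.pair (v 0) (v 1) = v 2) := by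
  refine (Sigma1.or (Sigma1.and (.lt (.var 0) (.var 1))
      (.eq (.add (.mul (.var 1) (.var 1)) (.var 0)) (.var 2)))
    (Sigma1.and (.le (.var 1) (.var 0))
      (.eq (.add (.add (.mul (.var 0) (.var 0)) (.var 0)) (.var 1)) (.var 2)))).congr fun v => ?_
  unfold Nat.pair
  split_ifs with h
  · simp [h, not_le.2 h]
  · simp [h, not_lt.1 h]

theorem Sigma1.pair (hs : PolyT s) (ht : PolyT t) (hu : PolyT u) :
    Sigma1 (fun v => Nat.pair (s v) (t v) = u v) :=
  Sigma1.comp₃ (fun x y z => Nat.pair x y = z) sigma1_pair hs ht hu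

theorem sigma1_beta : Sigma1 (k := 3) (fun v => Nat.beta (v 0) (v 1) = v 2) := by
  -- Division with remainder: `c` is the quotient of `p` by the modulus `(v 1 + 1) * q + 1`, and `v
  -- 2` the remainder.
  have h : Sigma1 (k := 3) (fun v => ∃ p q c, Nat.pair p q = v 0 ∧
      (((v 1 + 1) * q + 1) * c + v 2 = p ∧ v 2 < (v 1 + 1) * q + 1)) :=
    Sigma1.ex <| Sigma1.ex <| Sigma1.ex <| Sigma1.and (.pair (.var 2) (.var 1) (.var 3))
      (.and (.eq (.add (.mul (.add (.mul (.add (.var 4) (.const 1)) (.var 1)) (.const 1)) (.var 0))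
        (.var 5)) (.var 2))
        (.lt (.var 5) (.add (.mul (.add (.var 4) (.const 1)) (.var 1)) (.const 1))))
  refine h.congr fun v => ?_
  unfold Nat.beta
  constructor
  · intro h
    refine ⟨_, _, (v 0).unpair.1 / ((v 1 + 1) * (v 0).unpair.2 + 1), Nat.pair_unpair (v 0), ?_, ?_⟩
    · rw [← h]
      exact Nat.div_add_mod _ _
    · rw [← h]
      exact Nat.mod_lt _ (Nat.succ_pos _)
  · rintro ⟨p, q, c, h0, h1, h2⟩
    rw [← h0, Nat.unpair_pair, ← h1]
    simp only
    rw [Nat.mul_add_mod, Nat.mod_eq_of_lt h2]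

theorem Sigma1.beta (hs : PolyT s) (ht : PolyT t) (hu : PolyT u) :
    Sigma1 (fun v => Nat.beta (s v) (t v) = u v) :=
  Sigma1.comp₃ (fun x y z => Nat.beta x y = z) sigma1_beta hs ht hu

theorem mem_rec_iff (f g : ℕ →. ℕ) (a n y : ℕ) :
    y ∈ (Nat.rec (f a) (fun i IH => IH.bind fun z => g (Nat.pair a (Nat.pair i z))) n : Part ℕ) ↔
      ∃ s : ℕ → ℕ, s 0 ∈ f a ∧ (∀ i < n, s (i + 1) ∈ g (Nat.pair a (Nat.pair i (s i)))) ∧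
        s n = y := by
  induction n generalizing y with
  | zero =>
    constructor
    · exact fun h => ⟨fun _ => y, h, by simp, rfl⟩
    · rintro ⟨s, h, -, rfl⟩
      exact h
  | succ n ih =>
    simp only [Part.mem_bind_iff, ih]
    constructor
    · rintro ⟨z, ⟨s, h0, h1, rfl⟩, hy⟩
      refine ⟨fun i => if i ≤ n then s i else y, by simpa using h0, fun i hi => ?_, by simp⟩
      have hi' : i ≤ n := Nat.lt_succ_iff.1 hi
      rcases hi'.lt_or_eq with hlt | rfl
      · simpa [hi', hlt] using h1 i hlt
      · simpa using hy
    · rintro ⟨s, h0, h1, rfl⟩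
      exact ⟨s n, ⟨s, h0, fun i hi => h1 i (by omega), rfl⟩, h1 n (Nat.lt_succ_self n)⟩

/-- Only the values up to `n` matter, and a finite list is coded by one number through Gödel's
β-function. Quantification over runs of a recursion becomes quantification over numbers. -/
theorem exists_beta_iff (n : ℕ) (P : ℕ → Prop) (Q : ℕ → ℕ → ℕ → Prop) (R : ℕ → Prop) :
    (∃ s : ℕ → ℕ, P (s 0) ∧ (∀ i < n, Q i (s i) (s (i + 1))) ∧ R (s n)) ↔
      ∃ c, P (Nat.beta c 0) ∧ (∀ i < n, Q i (Nat.beta c i) (Nat.beta c (i + 1))) ∧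
        R (Nat.beta c n) := by
  constructor
  · rintro ⟨s, h0, h1, h2⟩
    have hb : ∀ i ≤ n, Nat.beta (Nat.unbeta (List.ofFn fun i : Fin (n + 1) => s i)) i = s i := by
      intro i hi
      have := Nat.beta_unbeta_coe (List.ofFn fun i : Fin (n + 1) => s i)
        ⟨i, by simpa using Nat.lt_succ_of_le hi⟩
      rwa [Fin.getElem_fin, List.getElem_ofFn] at this
    refine ⟨Nat.unbeta (List.ofFn fun i : Fin (n + 1) => s i), ?_, fun i hi => ?_, ?_⟩
    · rwa [hb 0 (Nat.zero_le _)]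
    · rw [hb i hi.le, hb (i + 1) hi]
      exact h1 i hi
    · rwa [hb n le_rfl]
  · rintro ⟨c, h⟩
    exact ⟨Nat.beta c, h⟩

theorem sigma1_of_partrec {f : ℕ →. ℕ} (hf : Nat.Partrec f) :
    Sigma1 (k := 2) (fun v => v 1 ∈ f (v 0)) := by
  induction hf with
  | zero => exact (Sigma1.eq (.var 1) (.const 0)).congr fun v => by simp [pure, PFun.pure]
  | succ => exact (Sigma1.eq (.var 1) (.add (.var 0) (.const 1))).congr fun v => by simp
  | left =>
    refine (Sigma1.ex (P := fun v z => Nat.pair (v 1) z = v 0)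
      (.pair (.var 2) (.var 0) (.var 1))).congr fun v => ?_
    simp only [PFun.coe_val, Part.mem_some_iff]
    constructor
    · intro h; exact ⟨_, by rw [h]; exact Nat.pair_unpair _⟩
    · rintro ⟨z, h⟩; rw [← h]; simp
  | right =>
    refine (Sigma1.ex (P := fun v z => Nat.pair z (v 1) = v 0)
      (.pair (.var 0) (.var 2) (.var 1))).congr fun v => ?_
    simp only [PFun.coe_val, Part.mem_some_iff]
    constructor
    · intro h; exact ⟨_, by rw [h]; exact Nat.pair_unpair _⟩
    · rintro ⟨z, h⟩; rw [← h]; simp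
  | @pair f g _ _ hf hg =>
    have h : Sigma1 (k := 2) (fun v => ∃ a b, a ∈ f (v 0) ∧ b ∈ g (v 0) ∧ Nat.pair a b = v 1) :=
      .ex <| .ex <| .and (.comp₂ (fun x y => y ∈ f x) hf (.var 2) (.var 1)) <|
        .and (.comp₂ (fun x y => y ∈ g x) hg (.var 2) (.var 0)) (.pair (.var 1) (.var 0) (.var 3))
    refine h.congr fun v => ?_
    simp only [Seq.seq, Part.mem_bind_iff, Part.map_eq_map, Part.mem_map_iff]
    constructor
    · rintro ⟨_, ⟨a, ha, rfl⟩, b, hb, h⟩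
      exact ⟨a, b, ha, hb, h⟩
    · rintro ⟨a, b, ha, hb, h⟩
      exact ⟨_, ⟨a, ha, rfl⟩, b, hb, h⟩
  | @comp f g _ _ hf hg =>
    have h : Sigma1 (k := 2) (fun v => ∃ a, a ∈ g (v 0) ∧ v 1 ∈ f a) :=
      .ex <| .and (.comp₂ (fun x y => y ∈ g x) hg (.var 1) (.var 0))
        (.comp₂ (fun x y => y ∈ f x) hf (.var 0) (.var 2))
    exact h.congr fun v => Part.mem_bind_iff
  | @prec f g _ _ hf hg =>
    -- The number `c` codes the run of the recursion. Intermediate values get names of their own,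
    -- since only graphs, not the functions themselves, are available as Σ₁ relations.
    have h : Sigma1 (k := 2) (fun v => ∃ a n, Nat.pair a n = v 0 ∧ ∃ c,
        (∃ z, Nat.beta c 0 = z ∧ z ∈ f a) ∧
        (∀ i < n, ∃ z z' p q, Nat.beta c i = z ∧ Nat.beta c (i + 1) = z' ∧ Nat.pair i z = p ∧
          Nat.pair a p = q ∧ z' ∈ g q) ∧ Nat.beta c n = v 1) :=
      .ex <| .ex <| .and (.pair (.var 1) (.var 0) (.var 2)) <| .ex <|
        .and (.ex <| .and (.beta (.var 1) (.const 0) (.var 0))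
          (.comp₂ (fun x y => y ∈ f x) hf (.var 3) (.var 0))) <|
        .and (.ball (.var 1) <| .ex <| .ex <| .ex <| .ex <|
          .and (.beta (.var 5) (.var 4) (.var 3)) <|
          .and (.beta (.var 5) (.add (.var 4) (.const 1)) (.var 2)) <|
          .and (.pair (.var 4) (.var 3) (.var 1)) <|
          .and (.pair (.var 7) (.var 1) (.var 0)) <|
          .comp₂ (fun x y => y ∈ g x) hg (.var 0) (.var 2))
          (.beta (.var 0) (.var 1) (.var 4))
    refine h.congr fun v => ?_
    obtain ⟨a, n, hv⟩ : ∃ a n, Nat.pair a n = v 0 := ⟨_, _, Nat.pair_unpair (v 0)⟩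
    rw [← hv]
    have h1 : ∀ a' n', (Nat.pair a' n' = Nat.pair a n) ↔ (a' = a ∧ n' = n) := fun a' n' =>
      Nat.pair_eq_pair
    have h2 := mem_rec_iff f g a n (v 1)
    rw [exists_beta_iff n (fun x => x ∈ f a) (fun i z z' => z' ∈ g (Nat.pair a (Nat.pair i z)))
      (fun x => x = v 1)] at h2
    simp only [Nat.unpaired, Nat.unpair_pair, h1]
    refine h2.trans ?_
    constructor
    · rintro ⟨c, h0, h1, h2⟩
      exact ⟨a, n, ⟨rfl, rfl⟩, c, ⟨_, rfl, h0⟩,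
        fun i hi => ⟨_, _, _, _, rfl, rfl, rfl, rfl, h1 i hi⟩, h2⟩
    · rintro ⟨_, _, ⟨rfl, rfl⟩, c, ⟨_, rfl, h0⟩, h1, h2⟩
      refine ⟨c, h0, fun i hi => ?_, h2⟩
      obtain ⟨_, _, _, _, rfl, rfl, rfl, rfl, h⟩ := h1 i hi
      exact h
  | @rfind f _ hf =>
    -- That `f` is defined and nonzero below the result is expressed by values of the form `y + 1`,
    -- which keeps the condition Σ₁.
    have h : Sigma1 (k := 2) (fun v => (∃ p, Nat.pair (v 0) (v 1) = p ∧ 0 ∈ f p) ∧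
        ∀ m < v 1, ∃ p y, Nat.pair (v 0) m = p ∧ y + 1 ∈ f p) :=
      .and (.ex <| .and (.pair (.var 1) (.var 2) (.var 0))
        (.comp₂ (fun x y => y ∈ f x) hf (.var 0) (.const 0))) <|
      .ball (.var 1) <| .ex <| .ex <| .and (.pair (.var 3) (.var 2) (.var 1))
        (.comp₂ (fun x y => y ∈ f x) hf (.var 1) (.add (.var 0) (.const 1)))
    refine h.congr fun v => ?_
    refine Nat.mem_rfind.trans ?_
    simp only [Part.map_eq_map, Part.mem_map_iff, decide_eq_true_eq, decide_eq_false_iff_not,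
      exists_eq_left', exists_eq_right]
    refine and_congr Iff.rfl (forall₂_congr fun m hm => ?_)
    constructor
    · rintro ⟨z, hz, h0⟩
      obtain ⟨y, rfl⟩ := Nat.exists_eq_succ_of_ne_zero h0
      exact ⟨_, y, rfl, hz⟩
    · rintro ⟨_, y, rfl, hz⟩
      exact ⟨_, hz, Nat.succ_ne_zero y⟩

theorem sigma1_of_computable {f : ℕ → ℕ} (hf : Computable f) :
    Sigma1 (k := 2) (fun v => f (v 0) = v 1) :=
  (sigma1_of_partrec (Partrec.nat_iff.1 hf)).congr fun v => by simp [eq_comm]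

/-- The graph of exponentiation with a fixed base. -/
theorem sigma1_pow (b : ℕ) : Sigma1 (k := 2) (fun v => b ^ v 0 = v 1) := by
  have h : Sigma1 (k := 2) (fun v => ∃ c, Nat.beta c 0 = 1 ∧
      (∀ i < v 0, ∃ z, Nat.beta c i = z ∧ Nat.beta c (i + 1) = b * z) ∧
      Nat.beta c (v 0) = v 1) :=
    .ex <| .and (.beta (.var 0) (.const 0) (.const 1)) <|
      .and (.ball (.var 1) <| .ex <| .and (.beta (.var 2) (.var 1) (.var 0))
        (.beta (.var 2) (.add (.var 1) (.const 1)) (.mul (.const b) (.var 0))))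
      (.beta (.var 0) (.var 1) (.var 2))
  refine h.congr fun v => ?_
  have h2 := exists_beta_iff (v 0) (fun x => x = 1) (fun _ z z' => z' = b * z) (fun x => x = v 1)
  simp only [exists_eq_left']
  rw [← h2]
  constructor
  · exact fun hv => ⟨fun i => b ^ i, pow_zero b, fun i _ => pow_succ' b i, hv⟩
  · rintro ⟨s, h0, h1, h2⟩
    have : ∀ i ≤ v 0, s i = b ^ i := by
      intro i
      induction i with
      | zero => exact fun _ => h0
      | succ i ih => exact fun hi => by rw [h1 i (by omega), ih (by omega), pow_succ']
    rw [← this _ le_rfl, h2]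

end

/-! ### Strings as numbers -/

theorem Symbol.digit_pos (a : Symbol) : 0 < a.digit := by cases a <;> simp [Symbol.digit]

theorem Symbol.digit_lt (a : Symbol) : a.digit < 12 := by cases a <;> simp [Symbol.digit]

theorem Symbol.digit_injective : Function.Injective Symbol.digit := by
  intro a b h
  cases a <;> cases b <;> simp [Symbol.digit] at h ⊢

theorem digits_stringNumber (s : List Symbol) :
    Nat.digits 12 (stringNumber s) = (s.map Symbol.digit).reverse := by
  refine Nat.digits_ofDigits 12 (by norm_num) _ (fun l hl => ?_) (fun h => ?_)
  · simp only [List.mem_reverse, List.mem_map] at hl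
    obtain ⟨a, -, rfl⟩ := hl
    exact a.digit_lt
  · have := List.getLast_mem h
    rw [List.mem_reverse, List.mem_map] at this
    obtain ⟨a, -, ha⟩ := this
    rw [← ha]
    exact a.digit_pos.ne'

theorem stringNumber_injective : Function.Injective stringNumber := by
  intro s t h
  have := congrArg (Nat.digits 12) h
  rw [digits_stringNumber, digits_stringNumber, List.reverse_inj] at this
  exact List.map_injective_iff.2 Symbol.digit_injective this

theorem stringNumber_append (s t : List Symbol) :
    stringNumber (s ++ t) = concat (stringNumber s) (stringNumber t) := by
  rw [concat, digits_stringNumber, digits_stringNumber, stringNumber, List.map_append,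
    List.reverse_append]

theorem stringNumber_cons (a : Symbol) (s : List Symbol) :
    stringNumber (a :: s) = a.digit * 12 ^ s.length + stringNumber s := by
  simp only [stringNumber, List.map_cons, List.reverse_cons, Nat.ofDigits_append,
    Nat.ofDigits_singleton, List.length_reverse, List.length_map]
  ring

/-- The conditions force `k` to be the number of base-12 digits of `y`. The alternative `k = 0`
covers `y = 0`, which has no digits. -/
theorem concat_eq_iff (x y z : ℕ) :
    concat x y = z ↔
      ∃ k p, 12 ^ k = p ∧ y < p ∧ (k = 0 ∨ p ≤ 12 * y) ∧ x * p + y = z := by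
  have hc : concat x y = x * 12 ^ (Nat.digits 12 y).length + y := by
    rw [concat, Nat.ofDigits_append, Nat.ofDigits_digits, Nat.ofDigits_digits]
    ring
  rw [hc]
  constructor
  · intro h
    refine ⟨_, _, rfl, Nat.lt_base_pow_length_digits (by norm_num), ?_, h⟩
    rcases Nat.eq_zero_or_pos y with rfl | hy
    · left; simp
    · right; exact Nat.base_pow_length_digits_le 12 y (by norm_num) hy.ne'
  · rintro ⟨k, _, rfl, h1, h2, h3⟩
    have : (Nat.digits 12 y).length = k := by
      refine le_antisymm ((Nat.digits_length_le_iff (by norm_num) y).2 h1) ?_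
      rcases h2 with rfl | h2
      · exact Nat.zero_le _
      · cases k with
        | zero => exact Nat.zero_le _
        | succ k =>
          refine (Nat.lt_digits_length_iff (by norm_num) y).2 ?_
          rw [pow_succ'] at h2
          omega
    rw [this, h3]

theorem sigma1_concat : Sigma1 (k := 3) (fun v => concat (v 0) (v 1) = v 2) := by
  have h : Sigma1 (k := 3) (fun v => ∃ k p, 12 ^ k = p ∧ v 1 < p ∧
      (k = 0 ∨ p ≤ 12 * v 1) ∧ v 0 * p + v 1 = v 2) :=
    .ex <| .ex <| .and (.comp₂ (fun x y => 12 ^ x = y) (sigma1_pow 12) (.var 1) (.var 0)) <|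
      .and (.lt (.var 3) (.var 0)) <|
      .and (.or (.eq (.var 1) (.const 0)) (.le (.var 0) (.mul (.const 12) (.var 3))))
        (.eq (.add (.mul (.var 2) (.var 0)) (.var 3)) (.var 4))
  exact h.congr fun v => concat_eq_iff _ _ _

theorem Sigma1.concat {k : ℕ} {s t u : (Fin k → ℕ) → ℕ} (hs : PolyT s) (ht : PolyT t)
    (hu : PolyT u) : Sigma1 (fun v => Arith.concat (s v) (t v) = u v) :=
  Sigma1.comp₃ (fun x y z => Arith.concat x y = z) sigma1_concat hs ht hu

/-! ### Numerals as strings -/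

theorem termString_tZero {n : ℕ} (ts : Fin 0 → lang.Term (Empty ⊕ Fin n)) :
    termString (Term.func (L := lang) Func.zero ts) = [Symbol.zero] := by
  simp [termString]

theorem termString_tSucc {n : ℕ} (ts : Fin 1 → lang.Term (Empty ⊕ Fin n)) :
    termString (Term.func (L := lang) Func.succ ts) = Symbol.succ :: termString (ts 0) := by
  simp [termString]

theorem termString_tAdd {n : ℕ} (ts : Fin 2 → lang.Term (Empty ⊕ Fin n)) :
    termString (Term.func (L := lang) Func.add ts) =
      Symbol.add :: (termString (ts 0) ++ termString (ts 1)) := by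
  simp [termString]

theorem termString_tMul {n : ℕ} (ts : Fin 2 → lang.Term (Empty ⊕ Fin n)) :
    termString (Term.func (L := lang) Func.mul ts) =
      Symbol.mul :: (termString (ts 0) ++ termString (ts 1)) := by
  simp [termString]

/-- The string of the numeral of `n`. -/
def numeralString : ℕ → List Symbol
  | 0 => [Symbol.zero]
  | n + 1 => Symbol.succ :: numeralString n

theorem termString_numeral {n : ℕ} (m : ℕ) :
    termString (numeral m : lang.Term (Empty ⊕ Fin n)) = numeralString m := by
  induction m with
  | zero => exact termString_tZero _
  | succ m ih => rw [numeral, tSucc, termString_tSucc, Matrix.cons_val_zero, ih, numeralString]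

theorem length_numeralString (m : ℕ) : (numeralString m).length = m + 1 := by
  induction m with
  | zero => rfl
  | succ m ih => rw [numeralString, List.length_cons, ih]

/-- The digits are `m` twos followed by a one. This is the geometric sum, cleared of subtraction and
division, so the graph reduces to that of powers of 12. -/
theorem stringNumber_numeralString (m : ℕ) :
    11 * stringNumber (numeralString m) + 13 = 24 * 12 ^ m := by
  induction m with
  | zero => simp [numeralString, stringNumber, Symbol.digit]
  | succ m ih =>
    rw [numeralString, stringNumber_cons, length_numeralString, Symbol.digit, pow_succ]
    omega

theorem sigma1_numeralString :
    Sigma1 (k := 2) (fun v => stringNumber (numeralString (v 0)) = v 1) := by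
  have h : Sigma1 (k := 2) (fun v => ∃ p, 12 ^ v 0 = p ∧ 11 * v 1 + 13 = 24 * p) :=
    .ex <| .and (.comp₂ (fun x y => 12 ^ x = y) (sigma1_pow 12) (.var 1) (.var 0)) <|
      .eq (.add (.mul (.const 11) (.var 2)) (.const 13)) (.mul (.const 24) (.var 0))
  refine h.congr fun v => ?_
  have := stringNumber_numeralString (v 0)
  simp only [exists_eq_left']
  omega

theorem Sigma1.numeralString {k : ℕ} {s t : (Fin k → ℕ) → ℕ} (hs : PolyT s) (ht : PolyT t) :
    Sigma1 (fun v => stringNumber (Arith.numeralString (s v)) = t v) :=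
  Sigma1.comp₂ (fun x y => stringNumber (Arith.numeralString x) = y) sigma1_numeralString hs ht

/-! ### Unique readability -/

/-- A variable carries no end mark: its ticks can be counted only if no further tick follows. This
proviso runs through all readability lemmas, and it can be met because no term or formula begins
with a tick. -/
theorem varString_append_inj {i j : ℕ} {r r' : List Symbol} (hr : r.head? ≠ some Symbol.tick)
    (hr' : r'.head? ≠ some Symbol.tick) (h : varString i ++ r = varString j ++ r') :
    i = j ∧ r = r' := by
  simp only [varString, List.cons_append, List.cons.injEq, true_and] at h
  induction i generalizing j with
  | zero =>
    cases j with
    | zero => simpa using h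
    | succ j =>
      rw [List.replicate_succ] at h
      simp only [List.replicate_zero, List.nil_append, List.cons_append] at h
      rw [h] at hr
      exact absurd rfl hr
  | succ i ih =>
    cases j with
    | zero =>
      rw [List.replicate_succ] at h
      simp only [List.replicate_zero, List.nil_append, List.cons_append] at h
      rw [← h] at hr'
      exact absurd rfl hr'
    | succ j =>
      simp only [List.replicate_succ, List.cons_append, List.cons.injEq, true_and] at h
      obtain ⟨rfl, h2⟩ := ih h
      exact ⟨rfl, h2⟩

theorem termString_var {n : ℕ} (i : Fin n) :
    termString (Term.var (L := lang) (Sum.inr i : Empty ⊕ Fin n)) = varString i := by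
  simp [termString]

theorem head?_termString_append {n : ℕ} (t : lang.Term (Empty ⊕ Fin n)) (r : List Symbol) :
    (termString t ++ r).head? ≠ some Symbol.tick := by
  cases t with
  | var i =>
    rcases i with i | i
    · exact i.elim
    · simp [termString_var, varString]
  | func f ts => cases f <;> simp [termString]

theorem termString_append_inj {n : ℕ} (t t' : lang.Term (Empty ⊕ Fin n)) {r r' : List Symbol}
    (hr : r.head? ≠ some Symbol.tick) (hr' : r'.head? ≠ some Symbol.tick)
    (h : termString t ++ r = termString t' ++ r') : t = t' ∧ r = r' := by
  induction t generalizing t' r r' with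
  | var i =>
    rcases i with i | i
    · exact i.elim
    cases t' with
    | var j =>
      rcases j with j | j
      · exact j.elim
      rw [termString_var, termString_var] at h
      obtain ⟨h1, h2⟩ := varString_append_inj hr hr' h
      rw [Fin.ext h1]
      exact ⟨rfl, h2⟩
    | func g ss => cases g <;> simp [termString, varString] at h
  | func f ts ih =>
    cases t' with
    | var j =>
      rcases j with j | j
      · exact j.elim
      cases f <;> simp [termString, varString] at h
    | func g ss =>
      cases f <;> cases g <;>
        simp only [termString_tZero, termString_tSucc, termString_tAdd, termString_tMul,
          List.cons_append, List.nil_append, List.append_assoc, List.cons.injEq, reduceCtorEq,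
          false_and, true_and] at h
      · exact ⟨congrArg _ (Subsingleton.elim _ _), h⟩
      · obtain ⟨h1, h2⟩ := ih 0 (ss 0) hr hr' h
        refine ⟨congrArg _ (funext fun i => ?_), h2⟩
        fin_cases i; exact h1
      all_goals
        obtain ⟨h1, h2⟩ := ih 0 (ss 0) (head?_termString_append _ _)
          (head?_termString_append _ _) h
        obtain ⟨h3, h4⟩ := ih 1 (ss 1) hr hr' h2
        refine ⟨congrArg _ (funext fun i => ?_), h4⟩
        fin_cases i
        · exact h1
        · exact h3

theorem formulaString_falsum {n : ℕ} :
    formulaString (BoundedFormula.falsum : lang.BoundedFormula Empty n) = [Symbol.bot] := by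
  simp [formulaString]

theorem formulaString_equal {n : ℕ} (s t : lang.Term (Empty ⊕ Fin n)) :
    formulaString (BoundedFormula.equal s t) = Symbol.eq :: (termString s ++ termString t) := by
  simp [formulaString]

theorem formulaString_neg {n : ℕ} (φ : lang.BoundedFormula Empty n) :
    formulaString (φ.imp BoundedFormula.falsum) = Symbol.neg :: formulaString φ := by
  simp [formulaString]

theorem formulaString_imp {n : ℕ} (φ : lang.BoundedFormula Empty n)
    {ψ : lang.BoundedFormula Empty n} (h : ψ ≠ BoundedFormula.falsum) :
    formulaString (φ.imp ψ) = Symbol.imp :: (formulaString φ ++ formulaString ψ) := by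
  cases ψ with
  | falsum => exact absurd rfl h
  | _ => simp [formulaString]

theorem formulaString_all {n : ℕ} (φ : lang.BoundedFormula Empty (n + 1)) :
    formulaString φ.all = Symbol.all :: (varString n ++ formulaString φ) := by
  simp [formulaString]

/-- The cases are those of `formulaString` rather than the constructors: an implication with
conclusion `⊥` begins with `¬`. Thus the first symbol determines the case. -/
theorem formulaString_cases {n : ℕ} (φ : lang.BoundedFormula Empty n) :
    φ = BoundedFormula.falsum ∨ (∃ s t, φ = BoundedFormula.equal s t) ∨
      (∃ ψ, φ = BoundedFormula.imp ψ BoundedFormula.falsum) ∨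
      (∃ ψ χ, χ ≠ BoundedFormula.falsum ∧ φ = BoundedFormula.imp ψ χ) ∨ ∃ ψ, φ = BoundedFormula.all ψ := by
  cases φ with
  | falsum => exact .inl rfl
  | equal s t => exact .inr (.inl ⟨s, t, rfl⟩)
  | rel R => exact R.elim
  | imp ψ χ =>
    by_cases h : χ = BoundedFormula.falsum
    · exact .inr (.inr (.inl ⟨ψ, by rw [h]⟩))
    · exact .inr (.inr (.inr (.inl ⟨ψ, χ, h, rfl⟩)))
  | all ψ => exact .inr (.inr (.inr (.inr ⟨ψ, rfl⟩)))

theorem head?_formulaString_append {n : ℕ} (φ : lang.BoundedFormula Empty n) (r : List Symbol) :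
    (formulaString φ ++ r).head? ≠ some Symbol.tick := by
  rcases formulaString_cases φ with rfl | ⟨s, t, rfl⟩ | ⟨ψ, rfl⟩ | ⟨ψ, χ, h, rfl⟩ | ⟨ψ, rfl⟩
  · simp [formulaString_falsum]
  · simp [formulaString_equal]
  · simp [formulaString_neg]
  · simp [formulaString_imp _ h]
  · simp [formulaString_all]

theorem formulaString_append_inj {n : ℕ} (φ φ' : lang.BoundedFormula Empty n)
    {r r' : List Symbol} (hr : r.head? ≠ some Symbol.tick) (hr' : r'.head? ≠ some Symbol.tick)
    (h : formulaString φ ++ r = formulaString φ' ++ r') : φ = φ' ∧ r = r' := by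
  induction φ generalizing r r' with
  | falsum =>
    rcases formulaString_cases φ' with rfl | ⟨s, t, rfl⟩ | ⟨ψ, rfl⟩ | ⟨ψ, χ, hχ, rfl⟩ | ⟨ψ, rfl⟩
    · exact ⟨rfl, List.append_cancel_left h⟩
    · simp [formulaString_falsum, formulaString_equal] at h
    · simp [formulaString_falsum, formulaString_neg] at h
    · simp [formulaString_falsum, formulaString_imp _ hχ] at h
    · simp [formulaString_falsum, formulaString_all] at h
  | equal s t =>
    rcases formulaString_cases φ' with rfl | ⟨s', t', rfl⟩ | ⟨ψ, rfl⟩ | ⟨ψ, χ, hχ, rfl⟩ | ⟨ψ, rfl⟩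
    · simp [formulaString_falsum, formulaString_equal] at h
    · simp only [formulaString_equal, List.cons_append, List.append_assoc, List.cons.injEq,
        true_and] at h
      obtain ⟨rfl, h2⟩ := termString_append_inj s s' (head?_termString_append _ _)
        (head?_termString_append _ _) h
      obtain ⟨rfl, h3⟩ := termString_append_inj t t' hr hr' h2
      exact ⟨rfl, h3⟩
    · simp [formulaString_equal, formulaString_neg] at h
    · simp [formulaString_equal, formulaString_imp _ hχ] at h
    · simp [formulaString_equal, formulaString_all] at h
  | rel R => exact R.elim
  | imp φ₁ φ₂ ih₁ ih₂ =>
    by_cases hφ : φ₂ = BoundedFormula.falsum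
    · subst hφ
      rcases formulaString_cases φ' with rfl | ⟨s, t, rfl⟩ | ⟨ψ, rfl⟩ | ⟨ψ, χ, hχ, rfl⟩ |
        ⟨ψ, rfl⟩
      · simp [formulaString_falsum, formulaString_neg] at h
      · simp [formulaString_equal, formulaString_neg] at h
      · simp only [formulaString_neg, List.cons_append, List.cons.injEq, true_and] at h
        obtain ⟨rfl, h2⟩ := ih₁ ψ hr hr' h
        exact ⟨rfl, h2⟩
      · simp [formulaString_neg, formulaString_imp _ hχ] at h
      · simp [formulaString_neg, formulaString_all] at h
    · rcases formulaString_cases φ' with rfl | ⟨s, t, rfl⟩ | ⟨ψ, rfl⟩ | ⟨ψ, χ, hχ, rfl⟩ |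
        ⟨ψ, rfl⟩
      · simp [formulaString_falsum, formulaString_imp _ hφ] at h
      · simp [formulaString_equal, formulaString_imp _ hφ] at h
      · simp [formulaString_neg, formulaString_imp _ hφ] at h
      · simp only [formulaString_imp _ hφ, formulaString_imp _ hχ, List.cons_append,
          List.append_assoc, List.cons.injEq, true_and] at h
        obtain ⟨rfl, h2⟩ := ih₁ ψ (head?_formulaString_append _ _)
          (head?_formulaString_append _ _) h
        obtain ⟨rfl, h3⟩ := ih₂ χ hr hr' h2
        exact ⟨rfl, h3⟩
      · simp [formulaString_imp _ hφ, formulaString_all] at h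
  | all φ ih =>
    rcases formulaString_cases φ' with rfl | ⟨s', t', rfl⟩ | ⟨ψ, rfl⟩ | ⟨ψ, χ, hχ, rfl⟩ | ⟨ψ, rfl⟩
    · simp [formulaString_falsum, formulaString_all] at h
    · simp [formulaString_equal, formulaString_all] at h
    · simp [formulaString_all, formulaString_neg] at h
    · simp [formulaString_all, formulaString_imp _ hχ] at h
    · simp only [formulaString_all, List.cons_append, List.append_assoc, List.cons.injEq,
        true_and] at h
      obtain ⟨rfl, h2⟩ := ih ψ hr hr' (List.append_cancel_left h)
      exact ⟨rfl, h2⟩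

theorem code_injective : Function.Injective code := by
  intro A B h
  have := stringNumber_injective h
  exact (formulaString_append_inj A B (r := []) (r' := []) (by simp) (by simp)
    (by rw [this])).1

/-! ### Codes of negations and implications -/

theorem code_falsum : code BoundedFormula.falsum = 6 := by
  simp [code, formulaString_falsum, stringNumber, Symbol.digit]

theorem code_not (A : lang.Sentence) :
    code (∼A) = concat (stringNumber [Symbol.neg]) (code A) := by
  rw [code, code, ← stringNumber_append]
  exact congrArg stringNumber (formulaString_neg A)

/-- The code of `A ⟹ B`, computed from the codes of `A` and `B`. -/
def impCode (x y : ℕ) : ℕ :=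
  if y = 6 then concat (stringNumber [Symbol.neg]) x
  else concat (concat (stringNumber [Symbol.imp]) x) y

theorem code_imp (A B : lang.Sentence) : code (A ⟹ B) = impCode (code A) (code B) := by
  unfold impCode
  by_cases hB : B = BoundedFormula.falsum
  · subst hB
    rw [if_pos code_falsum]
    exact code_not A
  · rw [if_neg fun h => hB (code_injective (h.trans code_falsum.symm))]
    rw [code, code, code, ← stringNumber_append, ← stringNumber_append]
    refine congrArg stringNumber ((formulaString_imp A hB).trans ?_)
    simp

theorem Sigma1.impCode {k : ℕ} {s t u : (Fin k → ℕ) → ℕ} (hs : PolyT s) (ht : PolyT t)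
    (hu : PolyT u) : Sigma1 (fun v => Arith.impCode (s v) (t v) = u v) := by
  refine Sigma1.comp₃ (fun x y z => Arith.impCode x y = z) ?_ hs ht hu
  have h : Sigma1 (k := 3) (fun v =>
      (v 1 = 6 ∧ Arith.concat (stringNumber [Symbol.neg]) (v 0) = v 2) ∨
      ((v 1 < 6 ∨ 6 < v 1) ∧ ∃ c, Arith.concat (stringNumber [Symbol.imp]) (v 0) = c ∧
        Arith.concat c (v 1) = v 2)) :=
    .or (.and (.eq (.var 1) (.const 6)) (.concat (.const _) (.var 0) (.var 2)))
      (.and (.or (.lt (.var 1) (.const 6)) (.lt (.const 6) (.var 1)))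
        (.ex (.and (.concat (.const _) (.var 1) (.var 0)) (.concat (.var 0) (.var 2) (.var 3)))))
  refine h.congr fun v => ?_
  unfold Arith.impCode
  split_ifs with h6
  · simp [h6]
  · have : v 1 < 6 ∨ 6 < v 1 := lt_or_gt_of_ne h6
    simp [h6, this]

theorem digits_concat {x : ℕ} (hx : x ≠ 0) (y : ℕ) :
    Nat.digits 12 (concat x y) = Nat.digits 12 y ++ Nat.digits 12 x := by
  refine Nat.digits_ofDigits 12 (by norm_num) _ (fun l hl => ?_) (fun h => ?_)
  · rcases List.mem_append.1 hl with hl | hl <;> exact Nat.digits_lt_base (by norm_num) hl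
  · have h' : Nat.digits 12 x ≠ [] := Nat.digits_ne_nil_iff_ne_zero.2 hx
    rw [List.getLast_append_of_ne_nil _ h']
    exact Nat.getLast_digit_ne_zero 12 hx

/-- If the string of a sentence of the form `⊥ ⟹ _` ends in the string `y`, then `y` is the string
of a sentence. -/
theorem exists_code_of_code_eq_impCode {C : lang.Sentence} {y : ℕ}
    (h : code C = impCode 6 y) : ∃ B : lang.Sentence, code B = y := by
  unfold impCode at h
  split_ifs at h with h6
  · exact ⟨_, code_falsum.trans h6.symm⟩
  have e : concat (stringNumber [Symbol.imp]) 6 = stringNumber [Symbol.imp, Symbol.bot] :=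
    (stringNumber_append [Symbol.imp] [Symbol.bot]).symm
  have hd := congrArg (Nat.digits 12) h
  rw [e, digits_concat (by simp [stringNumber, Symbol.digit, Nat.ofDigits_cons]), code, digits_stringNumber,
    digits_stringNumber] at hd
  have hd' := congrArg List.reverse hd
  simp only [List.reverse_reverse, List.reverse_append, List.map_cons, List.map_nil,
    List.cons_append, List.nil_append] at hd'
  -- Read from the most significant digit, the string of `C` is `→ ⊥` followed by a string `s` with
  -- the digits of `y`. Only an implication with premise `⊥` can begin like this.
  obtain ⟨a, s, hs, ha, hd₁⟩ := List.map_eq_cons_iff.1 hd'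
  obtain ⟨b, s, rfl, hb, hd₂⟩ := List.map_eq_cons_iff.1 hd₁
  obtain rfl := Symbol.digit_injective ha
  obtain rfl := Symbol.digit_injective hb
  have hy : y = stringNumber s := by
    rw [stringNumber, hd₂, List.reverse_reverse, Nat.ofDigits_digits]
  rcases formulaString_cases C with rfl | ⟨s, t, rfl⟩ | ⟨ψ, rfl⟩ | ⟨ψ, χ, hχ, rfl⟩ | ⟨ψ, rfl⟩
  · simp [formulaString_falsum] at hs
  · simp [formulaString_equal] at hs
  · simp [formulaString_neg] at hs
  · rw [formulaString_imp _ hχ] at hs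
    rcases formulaString_cases ψ with rfl | ⟨s, t, rfl⟩ | ⟨ψ, rfl⟩ | ⟨ψ, χ, hχ, rfl⟩ | ⟨ψ, rfl⟩
    · simp only [formulaString_falsum, List.cons_append, List.nil_append, List.cons.injEq,
        true_and] at hs
      exact ⟨χ, by rw [hy, ← hs, code]⟩
    · simp [formulaString_equal] at hs
    · simp [formulaString_neg] at hs
    · simp [formulaString_imp _ hχ] at hs
    · simp [formulaString_all] at hs
  · simp [formulaString_all] at hs

/-! ### Strings of substitution instances -/

/-- The string of a term with free variables, for which the strings `g` are substituted. -/
def openTermString {α : Type} {n : ℕ} (g : α → List Symbol) :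
    lang.Term (α ⊕ Fin n) → List Symbol
  | .var (.inl a) => g a
  | .var (.inr i) => varString i
  | .func (l := 0) Func.zero _ => [Symbol.zero]
  | .func (l := 1) Func.succ ts => Symbol.succ :: openTermString g (ts 0)
  | .func (l := 2) Func.add ts =>
      Symbol.add :: (openTermString g (ts 0) ++ openTermString g (ts 1))
  | .func (l := 2) Func.mul ts =>
      Symbol.mul :: (openTermString g (ts 0) ++ openTermString g (ts 1))

/-- The string of a formula with free variables, for which the strings `g` are substituted. -/
def openString {α : Type} (g : α → List Symbol) : {n : ℕ} → lang.BoundedFormula α n → List Symbol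
  | _, .falsum => [Symbol.bot]
  | _, .equal s t => Symbol.eq :: (openTermString g s ++ openTermString g t)
  | _, .rel r _ => r.elim
  | _, .imp φ .falsum => Symbol.neg :: openString g φ
  | _, .imp φ ψ => Symbol.imp :: (openString g φ ++ openString g ψ)
  | n, .all φ => Symbol.all :: (varString n ++ openString g φ)

theorem openString_imp {α : Type} (g : α → List Symbol) {n : ℕ} (φ : lang.BoundedFormula α n)
    {ψ : lang.BoundedFormula α n} (h : ψ ≠ BoundedFormula.falsum) :
    openString g (φ.imp ψ) = Symbol.imp :: (openString g φ ++ openString g ψ) := by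
  cases ψ with
  | falsum => exact absurd rfl h
  | _ => simp [openString]

/-- A string records only the numerical values of the variable indices, so a change of scope does
not affect it. -/
theorem termString_relabel {m n : ℕ} (f : Fin m → Fin n) (hf : ∀ i, (f i : ℕ) = i)
    (t : lang.Term (Empty ⊕ Fin m)) :
    termString (t.relabel (Sum.map id f : Empty ⊕ Fin m → Empty ⊕ Fin n)) = termString t := by
  induction t with
  | var i =>
    rcases i with i | i
    · exact i.elim
    · simp [Term.relabel, termString_var, hf]
  | func f ts ih => cases f <;> simp [Term.relabel, termString, ih]

theorem termString_subst {k m : ℕ} (ts : Fin k → lang.Term (Empty ⊕ Fin 0))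
    (t : lang.Term (Fin k ⊕ Fin m)) :
    termString ((t.subst (Sum.elim (Term.relabel Sum.inl ∘ ts) (Term.var ∘ Sum.inr))).relabel
      (BoundedFormula.relabelAux (n := 0) (id : Empty ⊕ Fin 0 → Empty ⊕ Fin 0) m)) =
      openTermString (fun i => termString (ts i)) t := by
  induction t with
  | var i =>
    rcases i with i | i
    · simp only [Term.subst, Sum.elim_inl, Function.comp_apply, openTermString,
        Term.relabel_relabel]
      rw [← termString_relabel (Fin.castAdd m : Fin 0 → Fin (0 + m)) (fun i => i.elim0) (ts i)]
      congr 2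
      ext j
      rcases j with j | j
      · exact j.elim
      · exact j.elim0
    · simp [Term.subst, BoundedFormula.relabelAux, Term.relabel, openTermString, termString_var]
  | func f ts ih => cases f <;> simp [Term.relabel, Term.subst, termString, openTermString, ih]

theorem formulaString_relabel_subst {k m : ℕ} (ts : Fin k → lang.Term (Empty ⊕ Fin 0))
    (φ : lang.BoundedFormula (Fin k) m) :
    formulaString (BoundedFormula.relabel (n := 0) (id : Empty ⊕ Fin 0 → Empty ⊕ Fin 0)
      (BoundedFormula.subst φ ts)) = openString (fun i => termString (ts i)) φ := by
  induction φ with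
  | falsum => rfl
  | equal s t =>
    rw [openString, ← termString_subst, ← termString_subst]
    rfl
  | rel R => exact R.elim
  | imp φ ψ ih₁ ih₂ =>
    -- Whether `¬` or `→` is written depends on the conclusion being `⊥`, which substitution and
    -- relabelling neither create nor destroy.
    cases ψ with
    | falsum =>
      rw [openString, ← ih₁]
      exact formulaString_neg _
    | rel R => exact R.elim
    | equal =>
      rw [openString_imp _ _ (by simp), ← ih₁, ← ih₂]
      exact formulaString_imp _ (fun h => by cases h)
    | imp =>
      rw [openString_imp _ _ (by simp), ← ih₁, ← ih₂]
      exact formulaString_imp _ (fun h => by cases h)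
    | all =>
      rw [openString_imp _ _ (by simp), ← ih₁, ← ih₂]
      exact formulaString_imp _ (fun h => by cases h)
  | @all m φ ih =>
    rw [openString, ← ih]
    refine (congrArg formulaString (BoundedFormula.relabel_all _ _)).trans ?_
    refine (formulaString_all _).trans ?_
    exact congrArg (fun i => Symbol.all :: (varString i ++ _)) (Nat.zero_add m)

theorem formulaString_app {k : ℕ} (φ : lang.Formula (Fin k))
    (ts : Fin k → lang.Term (Empty ⊕ Fin 0)) :
    formulaString (app φ ts) = openString (fun i => termString (ts i)) φ :=
  formulaString_relabel_subst ts φ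

theorem openTermString_relabel_inr {α : Type} {k m : ℕ} (g g' : α → List Symbol)
    (t : lang.Term (Fin k ⊕ Fin m)) :
    openTermString g (t.relabel
      (BoundedFormula.relabelAux (Sum.inr : Fin k → α ⊕ Fin k) m)) =
    openTermString g' (t.relabel
      (BoundedFormula.relabelAux (Sum.inr : Fin k → α ⊕ Fin k) m)) := by
  induction t with
  | var i =>
    rcases i with i | i <;> simp [BoundedFormula.relabelAux, Term.relabel, openTermString]
  | func f ts ih => cases f <;> simp [Term.relabel, openTermString, ih]

/-- After relabelling along `Sum.inr` no free variable is left, so the strings to be substituted are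
never consulted. -/
theorem openString_relabel_inr {α : Type} {k m : ℕ} (g g' : α → List Symbol)
    (φ : lang.BoundedFormula (Fin k) m) :
    openString g (φ.relabel (Sum.inr : Fin k → α ⊕ Fin k)) =
      openString g' (φ.relabel (Sum.inr : Fin k → α ⊕ Fin k)) := by
  induction φ with
  | falsum => rfl
  | equal s t =>
    change openString g (BoundedFormula.equal _ _) = openString g' (BoundedFormula.equal _ _)
    rw [openString, openString, openTermString_relabel_inr g g', openTermString_relabel_inr g g']
  | rel R => exact R.elim
  | imp φ ψ ih₁ ih₂ =>
    rw [BoundedFormula.relabel_imp]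
    by_cases h : BoundedFormula.relabel (Sum.inr : Fin k → α ⊕ Fin k) ψ = BoundedFormula.falsum
    · rw [h]
      rw [openString, openString]
      exact congrArg _ ih₁
    · rw [openString_imp _ _ h, openString_imp _ _ h]
      exact congrArg _ (congrArg₂ _ ih₁ ih₂)
  | all φ ih =>
    rw [BoundedFormula.relabel_all, openString, openString]
    exact congrArg _ (congrArg _ ih)

/-! ### Coded sets in models of Peano arithmetic -/

section Coding

variable {M : Type} [lang.Structure M] [PAModel M]

theorem Def.induction {k : ℕ}
    {P : ∀ (M : Type) [lang.Structure M] [PAModel M], (Fin (k + 1) → M) → Prop} (hP : Def P)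
    (p : Fin k → M) (h0 : P M (Fin.cons 0 p))
    (h1 : ∀ x, P M (Fin.cons x p) → P M (Fin.cons (x + 1) p)) (x : M) : P M (Fin.cons x p) := by
  obtain ⟨φ, hφ⟩ := hP
  simp only [← hφ] at h0 h1 ⊢
  exact PAModel.induction φ p h0 h1 x

/-- This replaces subtraction, which the semiring lacks: the order allows the two cofactors to be
subtracted. -/
theorem dvd_of_dvd_add {q x y : M} (hxy : q ∣ x + y) (hx : q ∣ x) : q ∣ y := by
  obtain ⟨c, rfl⟩ := hx
  obtain ⟨e, he⟩ := hxy
  rcases eq_or_ne q 0 with rfl | hq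
  · simp only [zero_mul, zero_add] at he
    rw [he]
  · have hce : c ≤ e := by
      by_contra h
      have := mul_lt_mul_of_pos_left (not_le.1 h) (pos_iff_ne_zero.2 hq)
      rw [← he] at this
      exact absurd this (not_lt.2 le_self_add)
    obtain ⟨f, rfl⟩ := exists_add_of_le hce
    rw [mul_add] at he
    exact ⟨f, add_left_cancel he⟩

/-- Membership of `x` in the set that is coded by `a` and `m`. -/
def Mem (a m x : M) : Prop := 1 + (x + 1) * m ∣ a

/-- A substitute for coprimality of distinct moduli. With `q = 1 + (x + 1) * m`, the other modulus
differs from `q` by `d * m`, where `d` is the distance of `x` and `t`; hence `q ∣ a * (d * m)`. As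
`d ∣ m`, also `q ∣ a * ((x + 1) * m) ^ 2`, and since `(x + 1) * m ≡ -1` modulo `q`, the square can
be removed. -/
theorem dvd_of_dvd_mul_of_ne {S m a x t : M} (hm : ∀ d, 0 < d → d ≤ S → d ∣ m) (hx : x ≤ S)
    (ht : t ≤ S) (hxt : x ≠ t) (h : 1 + (x + 1) * m ∣ a * (1 + (t + 1) * m)) :
    1 + (x + 1) * m ∣ a := by
  have key : ∀ d, 0 < d → d ≤ S → 1 + (x + 1) * m ∣ a * (d * m) → 1 + (x + 1) * m ∣ a := by
    intro d hd hdS hdvd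
    obtain ⟨k, hk⟩ := hm d hd hdS
    have h1 : 1 + (x + 1) * m ∣ a * ((x + 1) * m) * ((x + 1) * m) := by
      have e : a * ((x + 1) * m) * ((x + 1) * m) =
          a * (d * m) * (k * (x + 1) * (x + 1)) := by
        calc a * ((x + 1) * m) * ((x + 1) * m) = a * (x + 1) * (x + 1) * m * m := by ring
          _ = a * (x + 1) * (x + 1) * m * (d * k) := by rw [← hk]
          _ = _ := by ring
      rw [e]
      exact hdvd.mul_right _
    have h2 : 1 + (x + 1) * m ∣ a * ((x + 1) * m) := by
      refine dvd_of_dvd_add (x := a * ((x + 1) * m) * ((x + 1) * m)) ?_ h1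
      exact ⟨a * ((x + 1) * m), by ring⟩
    refine dvd_of_dvd_add (x := a * ((x + 1) * m)) ?_ h2
    exact ⟨a, by ring⟩
  rcases lt_or_gt_of_ne hxt with hlt | hlt
  · obtain ⟨d, rfl⟩ := exists_add_of_le hlt.le
    refine key d (pos_of_lt_add_right hlt) (le_add_self.trans ht) ?_
    refine dvd_of_dvd_add (x := a * (1 + (x + 1) * m)) ?_ (dvd_mul_left _ _)
    convert h using 1
    ring
  · obtain ⟨d, rfl⟩ := exists_add_of_le hlt.le
    refine key d (pos_of_lt_add_right hlt) (le_add_self.trans hx) ?_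
    refine dvd_of_dvd_add (x := a * (1 + (t + 1) * m)) ?_ h
    exact ⟨a, by ring⟩

theorem Def.dvd {k : ℕ} {t u : ∀ (M : Type) [lang.Structure M] [PAModel M], (Fin k → M) → M}
    (ht : DefT t) (hu : DefT u) : Def (fun M _ _ v => t M v ∣ u M v) :=
  Def.ex (P := fun M _ _ v c => u M v = t M v * c) (.eq hu.tail (.mul ht.tail (.var 0)))

/-- The role of `S!`. Induction is applied to the existence statement, so no factorial function has
to be defined. -/
theorem exists_common_multiple (S : M) : ∃ m : M, 0 < m ∧ ∀ d, 0 < d → d ≤ S → d ∣ m := by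
  have hdef : Def (k := 1) (fun M _ _ v => ∃ m : M, 0 < m ∧ ∀ d, 0 < d → d < v 0 + 1 → d ∣ m) :=
    .ex <| .and (.lt .zero (.var 0)) <| .all <| .imp (.lt .zero (.var 0)) <|
      .imp (.lt (.var 0) (.add (.var 2) .one)) (.dvd (.var 0) (.var 1))
  have := hdef.induction (M := M) ![] ?_ ?_ S
  · simpa only [Fin.cons_zero, lt_add_one_iff'] using this
  · refine ⟨1, zero_lt_one, fun d hd hd' => ?_⟩
    simp only [Fin.cons_zero, lt_add_one_iff'] at hd'
    exact absurd hd (not_lt.2 hd')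
  · rintro x ⟨m, hm, h⟩
    simp only [Fin.cons_zero, lt_add_one_iff'] at h ⊢
    have hx : (0 : M) < x + 1 := by
      rw [lt_add_one_iff']
      exact zero_le
    refine ⟨m * (x + 1), mul_pos hm hx, fun d hd hd' => ?_⟩
    rcases hd'.lt_or_eq with hlt | rfl
    · exact (h d hd ((lt_add_one_iff' _ _).1 hlt)).mul_right _
    · exact dvd_mul_left _ _

/-- Bounded comprehension: the restriction to `{x | x < S}` of a definable set is coded. -/
theorem Def.exists_code {k : ℕ}
    {P : ∀ (M : Type) [lang.Structure M] [PAModel M], (Fin (k + 1) → M) → Prop} (hP : Def P)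
    (p : Fin k → M) (S : M) :
    ∃ a m : M, ∀ x < S, Mem a m x ↔ P M (Fin.cons x p) := by
  obtain ⟨m, hm, hdvd⟩ := exists_common_multiple S
  -- Internal induction on `v 0`, the stage up to which elements have been admitted; `v 1` is `m`,
  -- `v 2` is `S`, and the rest are parameters.
  have hdef : Def (k := k + 3) (fun M _ _ v => ∃ a, ∀ x < v 2, 1 + (x + 1) * v 1 ∣ a ↔
      x < v 0 ∧ P M (Fin.cons x (fun i => v i.succ.succ.succ))) := by
    refine .ex <| .all <| .imp (.lt (.var 0) (.var 4)) <| .iff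
      (.dvd (.add .one (.mul (.add (.var 0) .one) (.var 3))) (.var 1)) <|
      .and (.lt (.var 0) (.var 2)) ?_
    refine (hP.subst (σ := Fin.cons (fun M _ _ v => v 0)
      (fun i M _ _ v => v i.succ.succ.succ.succ.succ)) (fun i => ?_)).congr
        fun M _ _ v => iff_of_eq (congrArg _ (funext fun i => ?_))
    · exact Fin.cases (.var 0) (fun i => .var i.succ.succ.succ.succ.succ) i
    · refine Fin.cases ?_ (fun i => ?_) i <;> simp [Fin.tail]
  have := hdef.induction (M := M) (Fin.cons m (Fin.cons S p)) ?_ ?_ S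
  · obtain ⟨a, ha⟩ := this
    exact ⟨a, m, fun x hx => (ha x hx).trans ⟨And.right, fun h => ⟨hx, h⟩⟩⟩
  -- The number 1 codes the empty set, since all moduli exceed 1.
  · refine ⟨1, fun x _ => ⟨fun h => ?_, fun h => absurd h.1 (by simp)⟩⟩
    change 1 + (x + 1) * m ∣ 1 at h
    obtain ⟨c, hc⟩ := h
    exfalso
    have hx : (0 : M) < (x + 1) * m :=
      mul_pos ((lt_add_one_iff' _ _).2 zero_le) hm
    rcases eq_or_ne c 0 with rfl | h0
    · simp at hc
    · have hc1 : 1 ≤ c := by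
        rw [← zero_add 1]
        exact (PAModel.add_one_le_iff' _ _).2 (pos_iff_ne_zero.2 h0)
      have h1 : (1 : M) < 1 + (x + 1) * m := lt_add_of_pos_right _ hx
      have h2 : (1 + (x + 1) * m) * 1 ≤ (1 + (x + 1) * m) * c :=
        mul_le_mul_of_nonneg_left hc1 zero_le
      rw [← hc, mul_one] at h2
      exact absurd h1 (not_lt.2 h2)
  · rintro t ⟨a, ha⟩
    change ∀ x < S, 1 + (x + 1) * m ∣ a ↔ x < t ∧ P M (Fin.cons x p) at ha
    change ∃ a, ∀ x < S, 1 + (x + 1) * m ∣ a ↔ x < t + 1 ∧ P M (Fin.cons x p)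
    by_cases hD : t < S ∧ P M (Fin.cons t p)
    -- Multiplying by the modulus of `t` admits `t`, and by `dvd_of_dvd_mul_of_ne` nothing else
    -- below `S`.
    · refine ⟨a * (1 + (t + 1) * m), fun x hx => ?_⟩
      rcases eq_or_ne x t with rfl | hxt
      · exact ⟨fun _ => ⟨lt_add_one x, hD.2⟩, fun _ => dvd_mul_left _ _⟩
      · rw [lt_add_one_iff', le_iff_lt_or_eq, or_iff_left hxt, ← ha x hx]
        exact ⟨dvd_of_dvd_mul_of_ne hdvd hx.le hD.1.le hxt, fun h => h.mul_right _⟩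
    · refine ⟨a, fun x hx => (ha x hx).trans ?_⟩
      rw [lt_add_one_iff', le_iff_lt_or_eq]
      constructor
      · exact fun h => ⟨.inl h.1, h.2⟩
      · rintro ⟨h | rfl, h'⟩
        · exact ⟨h, h'⟩
        · exact absurd ⟨hx, h'⟩ hD

/-- An injective pairing. -/
def pr (y r : M) : M := (y + r) * (y + r) + y

theorem pr_injective {y r y' r' : M} (h : pr y r = pr y' r') : y = y' ∧ r = r' := by
  have key : ∀ y r y' r' : M, y + r < y' + r' → pr y r < pr y' r' := by
    intro y r y' r' h
    have h1 : y + r + 1 ≤ y' + r' := (PAModel.add_one_le_iff' _ _).2 h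
    have h2 : (y + r + 1) * (y + r + 1) ≤ (y' + r') * (y' + r') := mul_le_mul' h1 h1
    have e : (y + r + 1) * (y + r + 1) = pr y r + (y + r + r + 1) := by
      unfold pr; ring
    calc pr y r < pr y r + (y + r + r + 1) :=
          lt_add_of_pos_right _ ((lt_add_one_iff' _ _).2 zero_le)
      _ = _ := e.symm
      _ ≤ (y' + r') * (y' + r') := h2
      _ ≤ pr y' r' := le_self_add
  rcases lt_trichotomy (y + r) (y' + r') with hlt | heq | hlt
  · exact absurd h (key _ _ _ _ hlt).ne
  · unfold pr at h
    rw [heq] at h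
    have hy := add_left_cancel h
    rw [hy] at heq
    exact ⟨hy, add_left_cancel heq⟩
  · exact absurd h (key _ _ _ _ hlt).ne'

theorem pr_lt {y r s : M} (hy : y < s) (hr : r < s) : pr y r < pr s s := by
  unfold pr
  exact add_lt_add_of_le_of_lt (mul_le_mul' (add_le_add hy.le hr.le) (add_le_add hy.le hr.le)) hy

end Coding

theorem DefT.pr {k : ℕ} {t u : ∀ (M : Type) [lang.Structure M] [PAModel M], (Fin k → M) → M}
    (ht : DefT t) (hu : DefT u) : DefT (fun M _ _ v => Arith.pr (t M v) (u M v)) :=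
  .add (.mul (.add ht hu) (.add ht hu)) ht

section

variable {k : ℕ} {s t u : ∀ (M : Type) [lang.Structure M] [PAModel M], (Fin k → M) → M}

theorem Abs.mem (hs : DefT s) (ht : DefT t) (hu : DefT u) :
    Abs (fun M _ _ v => Mem (s M v) (t M v) (u M v)) := by
  refine (Abs.bex (P := fun M _ _ v c => s M v = (1 + (u M v + 1) * t M v) * c)
    (.add hs .one) (.eq hs.tail
      (.mul (.add .one (.mul (.add hu.tail .one) ht.tail)) (.var 0)))).congr fun M _ _ v => ?_
  constructor
  · rintro ⟨c, hc⟩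
    refine ⟨c, ?_, hc⟩
    rw [hc, lt_add_one_iff', add_mul, one_mul]
    exact le_self_add
  · rintro ⟨c, -, hc⟩
    exact ⟨c, hc⟩

end

/-! ### Formal proofs as coded sets of ranked statements -/

section Proofs

variable {M : Type} [lang.Structure M] [PAModel M]

/-- All statements `y < s` whose pair with a rank `r < s` is in the set coded by `a` and `m` are
axioms, or follow by the rule `R` from statements of lower rank in this set. -/
def IsProof (Ax : M → Prop) (R : M → M → M → Prop) (a m s : M) : Prop :=
  ∀ y < s, ∀ r < s, Mem a m (pr y r) → Ax y ∨ ∃ z₁ < s, ∃ z₂ < s, ∃ r₁ < r, ∃ r₂ < r,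
    Mem a m (pr z₁ r₁) ∧ Mem a m (pr z₂ r₂) ∧ R z₁ z₂ y

/-- Provability from the axioms `Ax` with the rule `R`. -/
def Provable (Ax : M → Prop) (R : M → M → M → Prop) (x : M) : Prop :=
  ∃ a m s r, x < s ∧ r < s ∧ Mem a m (pr x r) ∧ IsProof Ax R a m s

theorem exists_code_union (a₁ m₁ s₁ a₂ m₂ s₂ y₀ r₀ S : M) :
    ∃ a m : M, ∀ i < S, Mem a m i ↔ ∃ y r, i = pr y r ∧ ((y < s₁ ∧ r < s₁ ∧ Mem a₁ m₁ i) ∨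
      (y < s₂ ∧ r < s₂ ∧ Mem a₂ m₂ i) ∨ (y = y₀ ∧ r = r₀)) := by
  have hdef : Def (k := 9) (fun M _ _ v => ∃ y r, v 0 = pr y r ∧
      ((y < v 3 ∧ r < v 3 ∧ Mem (v 1) (v 2) (v 0)) ∨
      (y < v 6 ∧ r < v 6 ∧ Mem (v 4) (v 5) (v 0)) ∨ (y = v 7 ∧ r = v 8))) :=
    .ex <| .ex <| .and (.eq (.var 2) (.pr (.var 1) (.var 0))) <|
      .or (.and (.lt (.var 1) (.var 5)) <| .and (.lt (.var 0) (.var 5)) <|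
        (Abs.mem (.var 3) (.var 4) (.var 2)).1) <|
      .or (.and (.lt (.var 1) (.var 8)) <| .and (.lt (.var 0) (.var 8)) <|
        (Abs.mem (.var 6) (.var 7) (.var 2)).1) <|
      .and (.eq (.var 1) (.var 9)) (.eq (.var 0) (.var 10))
  exact hdef.exists_code ![a₁, m₁, s₁, a₂, m₂, s₂, y₀, r₀] S

variable {Ax : M → Prop} {R : M → M → M → Prop}

/-- The two proofs are cut off at their bounds, beyond which their codes are unconstrained, then
united, and the pair of `y` and `r` is added. Old pairs keep their old justifications. Working with
sets and ranks instead of sequences avoids concatenation inside the model. -/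
theorem provable_of_isProof_of_isProof {a₁ m₁ s₁ a₂ m₂ s₂ y r : M}
    (h₁ : IsProof Ax R a₁ m₁ s₁) (h₂ : IsProof Ax R a₂ m₂ s₂)
    (hy : Ax y ∨ ∃ z₁ < s₁, ∃ z₂ < s₂, ∃ r₁ < s₁, ∃ r₂ < s₂, r₁ < r ∧ r₂ < r ∧
      Mem a₁ m₁ (pr z₁ r₁) ∧ Mem a₂ m₂ (pr z₂ r₂) ∧ R z₁ z₂ y) : Provable Ax R y := by
  let s := s₁ + s₂ + y + r + 1
  have hs₁ : s₁ ≤ s := by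
    simp only [s, add_assoc]
    exact le_self_add
  have hs₂ : s₂ ≤ s := by
    simp only [s, add_assoc]
    exact le_add_of_le_right le_self_add
  have hys : y < s := by
    simp only [s]
    rw [lt_add_one_iff']
    exact le_add_of_le_left le_add_self
  have hrs : r < s := by
    simp only [s]
    rw [lt_add_one_iff']
    exact le_add_self
  obtain ⟨a, m, h⟩ := exists_code_union a₁ m₁ s₁ a₂ m₂ s₂ y r (pr s s)
  have hmem₁ : ∀ z < s₁, ∀ q < s₁, Mem a₁ m₁ (pr z q) → Mem a m (pr z q) := fun z hz q hq hm =>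
    (h _ (pr_lt (hz.trans_le hs₁) (hq.trans_le hs₁))).2 ⟨z, q, rfl, .inl ⟨hz, hq, hm⟩⟩
  have hmem₂ : ∀ z < s₂, ∀ q < s₂, Mem a₂ m₂ (pr z q) → Mem a m (pr z q) := fun z hz q hq hm =>
    (h _ (pr_lt (hz.trans_le hs₂) (hq.trans_le hs₂))).2 ⟨z, q, rfl, .inr (.inl ⟨hz, hq, hm⟩)⟩
  refine ⟨a, m, s, r, hys, hrs, (h _ (pr_lt hys hrs)).2 ⟨y, r, rfl, .inr (.inr ⟨rfl, rfl⟩)⟩,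
    fun x hx q hq hxq => ?_⟩
  obtain ⟨x', q', he, hcase⟩ := (h _ (pr_lt hx hq)).1 hxq
  obtain ⟨rfl, rfl⟩ := pr_injective he
  rcases hcase with ⟨hx₁, hq₁, hm⟩ | ⟨hx₂, hq₂, hm⟩ | ⟨rfl, rfl⟩
  · refine (h₁ x hx₁ q hq₁ hm).imp id ?_
    rintro ⟨z₁, hz₁, z₂, hz₂, r₁, hr₁, r₂, hr₂, hm₁, hm₂, hR⟩
    exact ⟨z₁, hz₁.trans_le hs₁, z₂, hz₂.trans_le hs₁, r₁, hr₁, r₂, hr₂,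
      hmem₁ _ hz₁ _ (hr₁.trans hq₁) hm₁, hmem₁ _ hz₂ _ (hr₂.trans hq₁) hm₂, hR⟩
  · refine (h₂ x hx₂ q hq₂ hm).imp id ?_
    rintro ⟨z₁, hz₁, z₂, hz₂, r₁, hr₁, r₂, hr₂, hm₁, hm₂, hR⟩
    exact ⟨z₁, hz₁.trans_le hs₂, z₂, hz₂.trans_le hs₂, r₁, hr₁, r₂, hr₂,
      hmem₂ _ hz₁ _ (hr₁.trans hq₂) hm₁, hmem₂ _ hz₂ _ (hr₂.trans hq₂) hm₂, hR⟩
  · refine hy.imp id ?_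
    rintro ⟨z₁, hz₁, z₂, hz₂, r₁, hr₁, r₂, hr₂, hlt₁, hlt₂, hm₁, hm₂, hR⟩
    exact ⟨z₁, hz₁.trans_le hs₁, z₂, hz₂.trans_le hs₂, r₁, hlt₁, r₂, hlt₂,
      hmem₁ _ hz₁ _ hr₁ hm₁, hmem₂ _ hz₂ _ hr₂ hm₂, hR⟩

theorem isProof_zero (a m : M) : IsProof Ax R a m 0 := fun y hy => absurd hy (by simp)

theorem Provable.of_ax {y : M} (hy : Ax y) : Provable Ax R y :=
  -- With the bound 0 every code is an empty proof.
  provable_of_isProof_of_isProof (r := 0) (isProof_zero 0 0) (isProof_zero 0 0) (.inl hy)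

theorem Provable.of_rule {z₁ z₂ y : M} (h₁ : Provable Ax R z₁) (h₂ : Provable Ax R z₂)
    (hR : R z₁ z₂ y) : Provable Ax R y := by
  obtain ⟨a₁, m₁, s₁, r₁, hz₁, hr₁, hm₁, hp₁⟩ := h₁
  obtain ⟨a₂, m₂, s₂, r₂, hz₂, hr₂, hm₂, hp₂⟩ := h₂
  -- The new rank exceeds the ranks of both premises.
  refine provable_of_isProof_of_isProof (r := r₁ + r₂ + 1) hp₁ hp₂ (.inr
    ⟨z₁, hz₁, z₂, hz₂, r₁, hr₁, r₂, hr₂, ?_, ?_, hm₁, hm₂, hR⟩)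
  · exact (lt_add_one_iff' _ _).2 le_self_add
  · exact (lt_add_one_iff' _ _).2 le_add_self

end Proofs

/-- In the standard model, a property that holds for the axioms and is preserved by the rule holds
for everything that is provable. -/
theorem Provable.nat_induction {Ax : ℕ → Prop} {R : ℕ → ℕ → ℕ → Prop} {C : ℕ → Prop}
    (hAx : ∀ y, Ax y → C y)
    (hR : ∀ z₁ z₂ y, Provable Ax R z₁ → Provable Ax R z₂ → C z₁ → C z₂ → R z₁ z₂ y → C y)
    {x : ℕ} (hx : Provable Ax R x) : C x := by
  obtain ⟨a, m, s, r, hxs, hrs, hm, hp⟩ := hx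
  -- Ranks drop from conclusion to premises, and in `ℕ` they are well-founded. Provability of the
  -- premises is handed to `hR` as well, for the soundness of the rule from `A` to `Pvb(⌜A⌝)`.
  induction r using Nat.strong_induction_on generalizing x with
  | _ r ih =>
    rcases hp x hxs r hrs hm with h | ⟨z₁, hz₁, z₂, hz₂, r₁, hr₁, r₂, hr₂, hm₁, hm₂, h⟩
    · exact hAx x h
    · exact hR z₁ z₂ x ⟨a, m, s, r₁, hz₁, hr₁.trans hrs, hm₁, hp⟩
        ⟨a, m, s, r₂, hz₂, hr₂.trans hrs, hm₂, hp⟩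
        (ih r₁ hr₁ hz₁ (hr₁.trans hrs) hm₁) (ih r₂ hr₂ hz₂ (hr₂.trans hrs) hm₂) h

theorem mem_natCast {M : Type} [lang.Structure M] [PAModel M] (a m x : ℕ) :
    Mem (a : M) (m : M) (x : M) ↔ Mem a m x := by
  have := (Abs.mem (k := 3) (.var 0) (.var 1) (.var 2)).2 M ![a, m, x]
  simpa using this

theorem pr_natCast {M : Type} [lang.Structure M] [PAModel M] (y r : ℕ) :
    pr (y : M) (r : M) = ((pr y r : ℕ) : M) := by
  simp [pr]

/-- Provability in the standard model is preserved in all models. -/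
theorem Provable.natCast {M : Type} [lang.Structure M] [PAModel M] {Ax : ℕ → Prop}
    {R : ℕ → ℕ → ℕ → Prop} {Ax' : M → Prop} {R' : M → M → M → Prop}
    (hAx : ∀ y : ℕ, Ax y → Ax' y) (hR : ∀ z₁ z₂ y : ℕ, R z₁ z₂ y → R' z₁ z₂ y) {x : ℕ}
    (hx : Provable Ax R x) : Provable Ax' R' (x : M) := by
  obtain ⟨a, m, s, r, hxs, hrs, hm, hp⟩ := hx
  refine ⟨a, m, s, r, Nat.cast_lt.2 hxs, Nat.cast_lt.2 hrs, ?_, fun y hy q hq hyq => ?_⟩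
  · rwa [pr_natCast, mem_natCast]
  · obtain ⟨y, hy', rfl⟩ := lt_natCast_iff.1 hy
    obtain ⟨q, hq', rfl⟩ := lt_natCast_iff.1 hq
    rw [pr_natCast, mem_natCast] at hyq
    refine (hp y hy' q hq' hyq).imp (hAx y) ?_
    rintro ⟨z₁, hz₁, z₂, hz₂, r₁, hr₁, r₂, hr₂, hm₁, hm₂, h⟩
    refine ⟨z₁, Nat.cast_lt.2 hz₁, z₂, Nat.cast_lt.2 hz₂, r₁, Nat.cast_lt.2 hr₁, r₂,
      Nat.cast_lt.2 hr₂, ?_, ?_, hR _ _ _ h⟩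
    · rwa [pr_natCast, mem_natCast]
    · rwa [pr_natCast, mem_natCast]

/-- The parameter `v 1` of the rule is kept free: it will be the number `e`, which is computed from
the formula obtained here. -/
theorem Def.provable
    {Ax : ∀ (M : Type) [lang.Structure M] [PAModel M], (Fin 1 → M) → Prop} (hAx : Def Ax)
    {R : ∀ (M : Type) [lang.Structure M] [PAModel M], (Fin 4 → M) → Prop} (hR : Def R) :
    Def (k := 2) (fun M _ _ v => Provable (fun y => Ax M ![y])
      (fun z₁ z₂ y => R M ![v 1, z₁, z₂, y]) (v 0)) := by
  unfold Provable IsProof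
  refine .ex <| .ex <| .ex <| .ex <| .and (.lt (.var 4) (.var 1)) <|
    .and (.lt (.var 0) (.var 1)) <| .and (Abs.mem (.var 3) (.var 2) (.pr (.var 4) (.var 0))).1 <|
    .all <| .imp (.lt (.var 0) (.var 2)) <| .all <| .imp (.lt (.var 0) (.var 3)) <|
    .imp (Abs.mem (.var 5) (.var 4) (.pr (.var 1) (.var 0))).1 <| .or ?_ <|
    .ex <| .and (.lt (.var 0) (.var 4)) <| .ex <| .and (.lt (.var 0) (.var 5)) <|
    .ex <| .and (.lt (.var 0) (.var 3)) <| .ex <| .and (.lt (.var 0) (.var 4)) <|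
    .and (Abs.mem (.var 9) (.var 8) (.pr (.var 3) (.var 1))).1 <|
    .and (Abs.mem (.var 9) (.var 8) (.pr (.var 2) (.var 0))).1 ?_
  · refine (hAx.subst (σ := fun _ M _ _ v => v 1) (fun _ => .var 1)).congr
      fun M _ _ v => iff_of_eq (congrArg _ (funext fun i => ?_))
    fin_cases i; rfl
  · refine (hR.subst (σ := fun i M _ _ v => ![v 11, v 3, v 2, v 5] i) (fun i => ?_)).congr
      fun M _ _ v => Iff.rfl
    fin_cases i
    · exact .var 11
    · exact .var 3
    · exact .var 2
    · exact .var 5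

/-! ### Semantics of representations -/

section Semantics

variable {M : Type} [lang.Structure M]

theorem realize_comp_snoc {k : ℕ} {α : Type} (ts : Fin k → lang.Term α) (t : lang.Term α)
    (w : α → M) :
    (fun i => ((Fin.snoc ts t : Fin (k + 1) → lang.Term α) i).realize w) =
      (Fin.snoc (fun i => (ts i).realize w) (t.realize w) : Fin (k + 1) → M) := by
  ext i
  refine Fin.lastCases ?_ (fun i => ?_) i <;> simp

theorem realize_existsUniqueValue {k n : ℕ} (F : lang.Formula (Fin (k + 1)))
    (r : Fin k → lang.Term (Empty ⊕ Fin n)) (v : Empty → M) (xs : Fin n → M) :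
    (existsUniqueValue F r).Realize v xs ↔
      ∃ y, F.Realize (Fin.snoc (fun i => (r i).realize (Sum.elim v xs)) y : Fin (k + 1) → M) ∧
        ∀ z, F.Realize (Fin.snoc (fun i => (r i).realize (Sum.elim v xs)) z : Fin (k + 1) → M) →
          z = y := by
  simp only [existsUniqueValue, BoundedFormula.realize_ex, BoundedFormula.realize_inf,
    BoundedFormula.realize_all, BoundedFormula.realize_imp, BoundedFormula.realize_bdEqual,
    realize_app, realize_comp_snoc, realize_weaken]
  simp

theorem realize_atValue {k n : ℕ} (P : lang.Formula (Fin 1)) (F : lang.Formula (Fin (k + 1)))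
    (r : Fin k → lang.Term (Empty ⊕ Fin n)) (v : Empty → M) (xs : Fin n → M) :
    (atValue P F r).Realize v xs ↔ (existsUniqueValue F r).Realize v xs ∧
      ∃ y, F.Realize (Fin.snoc (fun i => (r i).realize (Sum.elim v xs)) y : Fin (k + 1) → M) ∧
        P.Realize ![y] := by
  simp only [atValue, BoundedFormula.realize_ex, BoundedFormula.realize_inf,
    realize_app, realize_comp_snoc, realize_weaken]
  refine and_congr Iff.rfl (exists_congr fun y => and_congr (by simp) ?_)
  refine iff_of_eq (congrArg _ (funext fun i => ?_))
  fin_cases i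
  simp

theorem models_app_iff {k : ℕ} (φ : lang.Formula (Fin k)) (ts : Fin k → lang.Term (Empty ⊕ Fin 0)) :
    (M ⊨ (app φ ts : lang.Sentence)) ↔
      φ.Realize (fun i => (ts i).realize (Sum.elim default default : Empty ⊕ Fin 0 → M)) :=
  realize_app φ ts _ _

theorem models_inf_iff (A B : lang.Sentence) :
    (M ⊨ (A ⊓ B : lang.Sentence)) ↔ M ⊨ A ∧ M ⊨ B := BoundedFormula.realize_inf

theorem models_imp_iff (A B : lang.Sentence) :
    (M ⊨ (A ⟹ B : lang.Sentence)) ↔ (M ⊨ A → M ⊨ B) := BoundedFormula.realize_imp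

theorem models_not_iff (A : lang.Sentence) : (M ⊨ (∼A : lang.Sentence)) ↔ ¬ M ⊨ A :=
  BoundedFormula.realize_not

variable [PAModel M]

theorem models_app_numeral_iff (φ : lang.Formula (Fin 1)) (n : ℕ) :
    (M ⊨ (app φ ![numeral n] : lang.Sentence)) ↔ φ.Realize ![(n : M)] := by
  rw [models_app_iff]
  refine iff_of_eq (congrArg _ (funext fun i => ?_))
  fin_cases i
  exact realize_numeral n _

theorem models_holdsOf_iff (P : lang.Formula (Fin 1)) (A : lang.Sentence) :
    M ⊨ holdsOf P A ↔ P.Realize ![(code A : M)] := models_app_numeral_iff P _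

theorem models_represents_iff {k : ℕ} (F : lang.Formula (Fin (k + 1))) (x : Fin k → ℕ) (y : ℕ) :
    (M ⊨ (existsUniqueValue F (fun i => numeral (x i)) ⊓
      app F (Fin.snoc (fun i => numeral (x i)) (numeral y)) : lang.Sentence)) ↔
    (∃ y', F.Realize (Fin.snoc (fun i => ((x i : ℕ) : M)) y' : Fin (k + 1) → M) ∧
      ∀ z, F.Realize (Fin.snoc (fun i => ((x i : ℕ) : M)) z : Fin (k + 1) → M) → z = y') ∧
    F.Realize (Fin.snoc (fun i => ((x i : ℕ) : M)) (y : M) : Fin (k + 1) → M) := by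
  rw [models_inf_iff, Sentence.Realize, Formula.Realize, realize_existsUniqueValue,
    models_app_iff, realize_comp_snoc]
  simp only [realize_numeral]

end Semantics

/-- Every function with a Σ₁ graph is correctly representable in every extension of Peano
arithmetic. -/
theorem exists_correctlyRepresents {T : lang.Theory} (hT : IsTheory T) (hPA : PA ⊆ T) {k : ℕ}
    {f : (Fin k → ℕ) → ℕ} (hf : Sigma1 (k := k + 1) (fun w => w 0 = f (Fin.tail w))) :
    ∃ F, CorrectlyRepresents T f F := by
  obtain ⟨F, hF⟩ := exists_formula_graph hf
  refine ⟨F, fun x y hxy => mem_of_forall_models hT hPA fun M _ _ _ => ?_, fun x y => ?_⟩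
  · rw [models_represents_iff]
    simp [hF, hxy]
  · rw [models_app_iff, realize_comp_snoc]
    simp only [realize_numeral]
    rw [hF]
    simp [eq_comm]

theorem sigma1_concatFun : Sigma1 (k := 3) (fun w => w 0 = concatFun (Fin.tail w)) :=
  (Sigma1.concat (.var 1) (.var 2) (.var 0)).congr fun _ => eq_comm

/-! ### Self-reference -/

/-- The beginning of the string of a formula `∀ v, v = t → φ`, up to the term `t`. -/
def headString : List Symbol :=
  [Symbol.all, Symbol.var, Symbol.imp, Symbol.eq, Symbol.var]

/-- The code of `∀ v, v = ⌜e⌝ → φ` if `e` is the number of the string of `φ`. -/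
def diagCode (e : ℕ) : ℕ :=
  concat (concat (stringNumber headString) (stringNumber (numeralString e))) e

theorem sigma1_diagCode : Sigma1 (k := 2) (fun w => w 0 = diagCode (w 1)) := by
  have h : Sigma1 (k := 2) (fun w => ∃ a b, stringNumber (numeralString (w 1)) = a ∧
      concat (stringNumber headString) a = b ∧ concat b (w 1) = w 0) :=
    .ex <| .ex <| .and (.numeralString (.var 3) (.var 1)) <|
      .and (.concat (.const _) (.var 1) (.var 0)) (.concat (.var 0) (.var 3) (.var 2))
  refine h.congr fun w => ?_
  simp only [exists_and_left, exists_eq_left']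
  exact eq_comm

/-- The diagonal lemma, for the negation of a formula with one free variable. -/
theorem exists_fixedPoint (P : lang.Formula (Fin 1)) :
    ∃ G : lang.Sentence, ∀ (M : Type) [lang.Structure M] [PAModel M],
      M ⊨ G ↔ ¬ P.Realize ![(code G : M)] := by
  obtain ⟨D, hD⟩ := exists_formula_graph (k := 1) (f := fun v => diagCode (v 0)) sigma1_diagCode
  let X : lang.BoundedFormula Empty 1 :=
    ∃' (app D (Fin.snoc ![&0] (&1)) ⊓ app P ![&1])
  let e := stringNumber (formulaString (∼X))
  -- Stating `v = ⌜e⌝` as a premise instead of substituting the numeral leaves the string of `∼X`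
  -- intact at the end of `G`. So the code of `G` arises by concatenation alone.
  let G : lang.Sentence := ∀' ((&0 =' numeral e) ⟹ ∼X)
  have hG : code G = diagCode e := by
    rw [diagCode, ← stringNumber_append, ← stringNumber_append]
    refine congrArg stringNumber ?_
    refine (formulaString_all _).trans ?_
    rw [formulaString_imp _ (fun h => by cases h)]
    refine congrArg (fun s => _ :: (_ ++ _ :: (s ++ _))) (formulaString_equal _ _) |>.trans ?_
    rw [termString_numeral]
    simp [headString, termString_var, varString]
  refine ⟨G, fun M _ _ => ?_⟩
  have hX : ∀ x : M, X.Realize default (Fin.snoc default x : Fin 1 → M) ↔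
      ∃ y, D.Realize (Fin.snoc ![x] y : Fin 2 → M) ∧ P.Realize ![y] := by
    intro x
    simp only [X, BoundedFormula.realize_ex, BoundedFormula.realize_inf, realize_app,
      realize_comp_snoc]
    refine exists_congr fun y => and_congr (iff_of_eq (congrArg _ (funext fun i => ?_)))
      (iff_of_eq (congrArg _ (funext fun i => ?_)))
    · fin_cases i <;> simp [Fin.snoc]
    · fin_cases i; simp [Fin.snoc]
  have h1 : M ⊨ G ↔ ¬ X.Realize default (Fin.snoc default (e : M) : Fin 1 → M) := by
    simp only [G, Sentence.Realize, Formula.Realize, BoundedFormula.realize_all,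
      BoundedFormula.realize_imp, BoundedFormula.realize_bdEqual, realize_numeral,
      BoundedFormula.realize_not]
    simp [Fin.snoc]
  have h2 : ∀ y : M, D.Realize (Fin.snoc ![(e : M)] y : Fin 2 → M) ↔ y = (code G : M) := by
    intro y
    rw [hG, ← hD M (fun _ => e) y]
    refine iff_of_eq (congrArg _ (funext fun i => ?_))
    fin_cases i <;> simp [Fin.snoc]
  rw [h1, hX]
  simp only [h2, exists_eq_left]

/-! ### The unprovability of consistency -/

theorem consistencyStatement_not_mem {T : lang.Theory} (hT : IsTheory T) (hPA : PA ⊆ T)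
    (hcons : Consistent T) {Pvb : lang.Formula (Fin 1)} {Cat : lang.Formula (Fin 3)}
    (hPvb : IsStrongProvabilityPredicate T Pvb) (hCat : Represents T concatFun Cat) :
    consistencyStatement Pvb Cat ∉ T := by
  intro hCon
  obtain ⟨G, hG⟩ := exists_fixedPoint Pvb
  have hG' : ∀ (M : Type) [lang.Structure M] [PAModel M], M ⊨ G ↔ ¬ M ⊨ holdsOf Pvb G :=
    fun M _ _ => (hG M).trans (not_congr (models_holdsOf_iff Pvb G).symm)
  have h1 : (G ⟹ ∼(holdsOf Pvb G) : lang.Sentence) ∈ T :=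
    mem_of_forall_models hT hPA fun M _ _ _ => by
      rw [models_imp_iff, models_not_iff]
      exact (hG' M).1
  have h2 : (∼(holdsOf Pvb G) : lang.Sentence) ∈ T := by
    -- In a model of `T` in which `Pvb(⌜G⌝)` holds, the code of `Pvb(⌜G⌝)` is the `x` that violates
    -- `Con`.
    refine mem_of_forall_models hT hPA fun M _ _ hM => (models_not_iff _).2 fun hX => ?_
    have h3 := hM.realize_of_mem _ (hPvb.representability _ h1)
    have h4 := hM.realize_of_mem _ (hPvb.distributivity G (∼(holdsOf Pvb G)))
    have h5 := hM.realize_of_mem _ (hPvb.reRepresentability G)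
    -- Since `∼` is written as a prefix, the code of the negation is the value of `⌢` at these
    -- arguments, so `Cat` finds it in the model.
    have h6 := hM.realize_of_mem _ (hCat ![stringNumber [Symbol.neg], code (holdsOf Pvb G)]
      (code (∼(holdsOf Pvb G))) (code_not _).symm)
    have h7 := hM.realize_of_mem _ hCon
    rw [models_imp_iff] at h5
    rw [models_imp_iff, models_imp_iff] at h4
    have hX1 := (models_holdsOf_iff _ _).1 (h5 hX)
    have hX2 := (models_holdsOf_iff _ _).1 (h4 h3 hX)
    rw [models_represents_iff] at h6
    refine (models_not_iff _).1 h7 ?_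
    rw [Sentence.Realize, Formula.Realize, BoundedFormula.realize_ex]
    refine ⟨(code (holdsOf Pvb G) : M), BoundedFormula.realize_inf.2 ⟨?_, ?_⟩⟩
    · rw [realize_app]
      convert hX1 using 1
      ext i; fin_cases i; simp [Fin.snoc]
    · have e : (fun i : Fin 2 => ((![numeral (stringNumber [Symbol.neg]), &0] :
          Fin 2 → lang.Term (Empty ⊕ Fin 1)) i).realize (Sum.elim (default : Empty → M)
            (Fin.snoc default (code (holdsOf Pvb G) : M) : Fin 1 → M))) =
          fun i => ((![stringNumber [Symbol.neg], code (holdsOf Pvb G)] i : ℕ) : M) := by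
        ext i
        fin_cases i
        · simp [realize_numeral]
        · simp [Fin.snoc]
      rw [realize_atValue, realize_existsUniqueValue, e]
      exact ⟨h6.1, _, h6.2, hX2⟩
  have h3 : G ∈ T := mem_of_forall_models hT hPA fun M _ _ hM =>
    (hG' M).2 ((models_not_iff _).1 (hM.realize_of_mem _ h2))
  exact hcons ⟨_, hPvb.representability G h3, h2⟩

/-! ### A strong provability predicate -/

theorem sigma1_of_computablyEnumerable {T : lang.Theory} (h : ComputablyEnumerable T) :
    Sigma1 (k := 1) (fun v => ∃ A ∈ T, code A = v 0) := by
  obtain ⟨pc, hpc, hv⟩ := h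
  have hf : Computable fun n : ℕ => Encodable.encode (pc n.unpair.1 n.unpair.2) :=
    Computable.encode.comp (hpc.comp (Computable.fst.comp Computable.unpair)
      (Computable.snd.comp Computable.unpair))
  have h : Sigma1 (k := 1) (fun v => ∃ p n, Nat.pair p (v 0) = n ∧
      -- The value `true` is encoded by 1.
      Encodable.encode (pc n.unpair.1 n.unpair.2) = 1) :=
    .ex <| .ex <| .and (.pair (.var 1) (.var 2) (.var 0)) <|
      .comp₂ (fun x y => Encodable.encode (pc x.unpair.1 x.unpair.2) = y)
        (sigma1_of_computable hf) (.var 0) (.const 1)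
  refine h.congr fun v => ?_
  simp only [exists_eq_left', Nat.unpair_pair]
  constructor
  · intro hA
    obtain ⟨p, hp⟩ := (hv (v 0)).1 hA
    exact ⟨p, by simp [hp]⟩
  · rintro ⟨p, hp⟩
    by_contra hA
    rw [(hv (v 0)).2 hA p] at hp
    simp at hp

/-- A formula `∀ v, v = x → ∀ v', v' = ⌜e⌝ → ¬ θ(v, v')` with the free variable `x`. -/
def selfRefFormula (θ : lang.Formula (Fin 2)) (e : ℕ) : lang.Formula (Fin 1) :=
  ∀' ((&0 =' Term.var (Sum.inl 0)) ⟹ ∀' ((&1 =' numeral e) ⟹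
    ∼(BoundedFormula.relabel (n := 2) (k := 0) (Sum.inr : Fin 2 → Fin 1 ⊕ Fin 2) θ)))

theorem realize_selfRefFormula {M : Type} [lang.Structure M] [PAModel M]
    (θ : lang.Formula (Fin 2)) (e : ℕ) (x : M) :
    (selfRefFormula θ e).Realize ![x] ↔ ¬ θ.Realize ![x, (e : M)] := by
  have key : ∀ a b : M, (BoundedFormula.relabel (n := 2) (k := 0)
      (Sum.inr : Fin 2 → Fin 1 ⊕ Fin 2) θ).Realize ![x]
        (Fin.snoc (Fin.snoc default a : Fin 1 → M) b : Fin 2 → M) ↔ θ.Realize ![a, b] := by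
    intro a b
    rw [show (BoundedFormula.relabel (n := 2) (k := 0)
      (Sum.inr : Fin 2 → Fin 1 ⊕ Fin 2) θ).Realize ![x] _ ↔ _ from BoundedFormula.realize_relabel,
      Formula.Realize]
    refine iff_of_eq (congr (congrArg _ (funext fun i => ?_)) (Subsingleton.elim _ _))
    fin_cases i <;> simp [Fin.snoc]
  simp only [selfRefFormula, Formula.Realize, BoundedFormula.realize_all,
    BoundedFormula.realize_imp, BoundedFormula.realize_bdEqual, realize_numeral,
    BoundedFormula.realize_not]
  constructor
  · intro h
    exact fun h' => h x (by simp [Fin.snoc]) (e : M) (by simp [Fin.snoc]) ((key _ _).2 h')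
  · intro h a ha b hb h'
    have ha' : a = x := by simpa [Fin.snoc] using ha
    have hb' : b = (e : M) := by simpa [Fin.snoc] using hb
    rw [← ha', ← hb'] at h
    exact h ((key a b).1 h')

/-- The part between `x` and `e` of the string of `∀ v, v = x → ∀ v', v' = e → φ`. -/
def middleString : List Symbol :=
  [Symbol.all, Symbol.var, Symbol.tick, Symbol.imp, Symbol.eq, Symbol.var, Symbol.tick]

/-- The code of `∀ v, v = ⌜y⌝ → ∀ v', v' = ⌜e⌝ → φ` if `e` is the number of the string of `φ`. -/
def instCode (e y : ℕ) : ℕ :=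
  concat (concat (concat (concat (stringNumber headString) (stringNumber (numeralString y)))
    (stringNumber middleString)) (stringNumber (numeralString e))) e

theorem sigma1_instCode : Sigma1 (k := 3) (fun v => instCode (v 0) (v 1) = v 2) := by
  have h : Sigma1 (k := 3) (fun v => ∃ a b c d f, stringNumber (numeralString (v 1)) = a ∧
      concat (stringNumber headString) a = b ∧ concat b (stringNumber middleString) = c ∧
      stringNumber (numeralString (v 0)) = d ∧ concat c d = f ∧ concat f (v 0) = v 2) :=
    .ex <| .ex <| .ex <| .ex <| .ex <| .and (.numeralString (.var 6) (.var 4)) <|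
      .and (.concat (.const _) (.var 4) (.var 3)) <| .and (.concat (.var 3) (.const _) (.var 2)) <|
      .and (.numeralString (.var 5) (.var 1)) <| .and (.concat (.var 2) (.var 1) (.var 0)) <|
      .concat (.var 0) (.var 5) (.var 7)
  refine h.congr fun v => ?_
  constructor
  · exact fun h => ⟨_, _, _, _, _, rfl, rfl, rfl, rfl, rfl, h⟩
  · rintro ⟨_, _, _, _, _, rfl, rfl, rfl, rfl, rfl, h⟩
    exact h

theorem openTermString_numeral {α : Type} {n : ℕ} (g : α → List Symbol) (m : ℕ) :
    openTermString g (numeral m : lang.Term (α ⊕ Fin n)) = numeralString m := by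
  induction m with
  | zero => simp [numeral, tZero, openTermString, numeralString]
  | succ m ih => simp [numeral, tSucc, openTermString, numeralString, ih]

/-- A formula can refer to the number `e` from which the codes of its instances are computed. -/
theorem exists_code_selfRefFormula (θ : lang.Formula (Fin 2)) :
    ∃ e, ∀ y, code (app (selfRefFormula θ e) ![numeral y]) = instCode e y := by
  let φ : lang.BoundedFormula (Fin 1) 2 :=
    ∼(BoundedFormula.relabel (n := 2) (k := 0) (Sum.inr : Fin 2 → Fin 1 ⊕ Fin 2) θ)
  have hφ : ∀ g g' : Fin 1 → List Symbol, openString g φ = openString g' φ := fun g g' =>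
    congrArg _ (openString_relabel_inr g g' θ)
  -- There is no circularity: `φ` depends on `θ` alone. It does not contain the variable `x` either,
  -- so any string, here the empty one, may stand in for `x`.
  refine ⟨stringNumber (openString (fun _ => []) φ), fun y => ?_⟩
  rw [code, formulaString_app, instCode]
  simp only [← stringNumber_append]
  refine congrArg stringNumber ?_
  unfold selfRefFormula
  rw [openString, openString_imp _ _ (fun h => by cases h), openString,
    openString_imp _ _ (fun h => by cases h)]
  simp [Term.bdEqual, openString, openTermString, headString, middleString, varString,
    termString_numeral, openTermString_numeral]
  exact hφ (fun _ => numeralString y) (fun _ => [])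

/-- The inference rule with the premises `z₁` and `z₂`: modus ponens, or from `A` to the formula
with the code `instCode e (code A)`. The second condition on modus ponens says that `y` is the code
of a sentence. -/
def Rule (T : lang.Theory) (e z₁ z₂ y : ℕ) : Prop :=
  (impCode z₂ y = z₁ ∧ ∃ A ∈ T, code A = impCode 6 y) ∨ instCode e z₁ = y

theorem sigma1_rule {T : lang.Theory} (h : ComputablyEnumerable T) :
    Sigma1 (k := 4) (fun v => Rule T (v 0) (v 1) (v 2) (v 3)) := by
  have h : Sigma1 (k := 4) (fun v => (impCode (v 2) (v 3) = v 1 ∧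
      ∃ c, impCode 6 (v 3) = c ∧ ∃ A ∈ T, code A = c) ∨ instCode (v 0) (v 1) = v 3) :=
    .or (.and (.impCode (.var 2) (.var 3) (.var 1)) <| .ex <|
      .and (.impCode (.const 6) (.var 4) (.var 0)) <|
      .comp₁ (fun x => ∃ A ∈ T, code A = x) (sigma1_of_computablyEnumerable h) (.var 0)) <|
      .comp₃ (fun x y z => instCode x y = z) sigma1_instCode (.var 0) (.var 1) (.var 3)
  refine h.congr fun v => ?_
  simp only [exists_eq_left']
  exact Iff.rfl

theorem IsTheory.mem_of_imp_mem {T : lang.Theory} (hT : IsTheory T) {A B : lang.Sentence}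
    (hAB : A ⟹ B ∈ T) (hA : A ∈ T) : B ∈ T :=
  hT B (Theory.models_sentence_iff.2 fun M =>
    (models_imp_iff A B).1 (M.is_model.realize_of_mem _ hAB) (M.is_model.realize_of_mem _ hA))

theorem IsTheory.exFalso_mem {T : lang.Theory} (hT : IsTheory T) (B : lang.Sentence) :
    BoundedFormula.falsum ⟹ B ∈ T :=
  hT _ (Theory.models_sentence_iff.2 fun _ => (models_imp_iff _ B).2 fun h => h.elim)

theorem exists_isStrongProvabilityPredicate {T : lang.Theory} (hT : IsTheory T)
    (hce : ComputablyEnumerable T) (hPA : PA ⊆ T) :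
    ∃ Pvb, IsStrongProvabilityPredicate T Pvb := by
  obtain ⟨Ax, hAx, hAxN, hAxM⟩ := (sigma1_of_computablyEnumerable hce).exists_upward
  obtain ⟨R, hR, hRN, hRM⟩ := (sigma1_rule hce).exists_upward
  -- `θ` expresses underivability, because `selfRefFormula` negates it.
  obtain ⟨θ, hθ⟩ := (hAx.provable hR).not
  -- This closes the loop: `instCode e (code A)` is now the code of the predicate applied to `A`, so
  -- the second rule is necessitation for the predicate being defined.
  obtain ⟨e, he⟩ := exists_code_selfRefFormula θ
  have hAx' : ∀ (M : Type) [lang.Structure M] [PAModel M], ∀ A ∈ T,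
      Ax M ![(code A : M)] := by
    intro M _ _ A hA
    convert hAxM M ![code A] ⟨A, hA, rfl⟩ using 1
    ext i; fin_cases i; rfl
  have hR' : ∀ (M : Type) [lang.Structure M] [PAModel M] (z₁ z₂ y : ℕ), Rule T e z₁ z₂ y →
      R M ![(e : M), (z₁ : M), (z₂ : M), (y : M)] := by
    intro M _ _ z₁ z₂ y h
    convert hRM M ![e, z₁, z₂, y] h using 1
    ext i; fin_cases i <;> rfl
  have hreal : ∀ (M : Type) [lang.Structure M] [PAModel M] (A : lang.Sentence),
      M ⊨ holdsOf (selfRefFormula θ e) A ↔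
        Provable (fun y => Ax M ![y]) (fun z₁ z₂ y => R M ![(e : M), z₁, z₂, y])
          (code A : M) := by
    intro M _ _ A
    rw [models_holdsOf_iff, realize_selfRefFormula, hθ, not_not]
    rfl
  have hup : ∀ (M : Type) [lang.Structure M] [PAModel M] (A : lang.Sentence),
      ℕ ⊨ holdsOf (selfRefFormula θ e) A → M ⊨ holdsOf (selfRefFormula θ e) A := by
    intro M _ _ A hA
    rw [hreal] at hA ⊢
    refine Provable.natCast (fun y hy => ?_) (fun z₁ z₂ y h => ?_) hA
    · obtain ⟨B, hB, hy⟩ := (hAxN ![y]).1 hy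
      have := hAx' M B hB
      rwa [hy] at this
    · exact hR' M z₁ z₂ y ((hRN _).1 h)
  have hrep : ∀ (M : Type) [lang.Structure M] [PAModel M], ∀ A ∈ T,
      M ⊨ holdsOf (selfRefFormula θ e) A := fun M _ _ A hA => by
    rw [hreal]
    exact .of_ax (hAx' M A hA)
  refine ⟨selfRefFormula θ e, fun A => ⟨fun hA => ?_, hrep ℕ A⟩, fun A hA => ?_,
    fun A B => ?_, fun A => ?_⟩
  · rw [hreal] at hA
    have hC : ∃ B ∈ T, code B = code A := by
      refine Provable.nat_induction (C := fun y => ∃ B ∈ T, code B = y)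
        (fun y hy => (hAxN ![y]).1 hy) (fun z₁ z₂ y h₁ _ hz₁ hz₂ h => ?_) hA
      obtain ⟨C, hC, rfl⟩ := hz₁
      obtain ⟨D, hD, rfl⟩ := hz₂
      rcases (hRN _).1 h with ⟨h, E, -, hE⟩ | h
      -- Modus ponens needs its conclusion to be a sentence; the side condition of `Rule` ensures it
      -- without any formalized syntax.
      · obtain ⟨B, hB⟩ := exists_code_of_code_eq_impCode hE
        change code B = y at hB
        change impCode (code D) y = code C at h
        rw [← hB, ← code_imp] at h
        rw [← code_injective h] at hC
        exact ⟨B, hT.mem_of_imp_mem hC hD, hB⟩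
      -- Soundness of necessitation: the derivation `h₁` of the premise in `ℕ` persists to all
      -- models of `T`, so the conclusion is in `T`.
      · refine ⟨holdsOf (selfRefFormula θ e) C, mem_of_forall_models hT hPA fun M _ _ _ =>
          hup M C ((hreal ℕ C).2 h₁), (he (code C)).trans h⟩
    obtain ⟨B, hB, hAB⟩ := hC
    rwa [← code_injective hAB]
  · exact mem_of_forall_models hT hPA fun M _ _ _ => hrep M A hA
  · refine mem_of_forall_models hT hPA fun M _ _ _ => ?_
    rw [models_imp_iff, models_imp_iff, hreal, hreal, hreal]
    exact fun h₁ h₂ => h₁.of_rule h₂ (hR' M _ _ _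
      -- The side condition holds because `⊥ ⟹ B` is always in `T`.
      (.inl ⟨(code_imp A B).symm, _, hT.exFalso_mem B, by rw [code_imp, code_falsum]⟩))
  · refine mem_of_forall_models hT hPA fun M _ _ _ => ?_
    rw [models_imp_iff, hreal, hreal]
    -- Necessitation has only one premise, so the second slot is filled with the same one.
    exact fun h => h.of_rule h (hR' M _ _ _ (.inr (he _).symm))

end Arith

theorem mainTheorem6 (T : Arith.lang.Theory) (hT : Arith.IsTheory T)
    (hce : Arith.ComputablyEnumerable T) (hPA : Arith.PA ⊆ T) :
    (∃ (Con : Arith.lang.Sentence) (Pvb : Arith.lang.Formula (Fin 1))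
        (Cat : Arith.lang.Formula (Fin 3)),
      Arith.IsStrongProvabilityPredicate T Pvb ∧
      Arith.CorrectlyRepresents T Arith.concatFun Cat ∧
      Con = Arith.consistencyStatement Pvb Cat) ∧
    (Arith.Consistent T →
      ∀ (Con : Arith.lang.Sentence) (Pvb : Arith.lang.Formula (Fin 1))
        (Cat : Arith.lang.Formula (Fin 3)),
      Arith.IsStrongProvabilityPredicate T Pvb →
      Arith.Represents T Arith.concatFun Cat →
      Con = Arith.consistencyStatement Pvb Cat →
      Con ∉ T) := by
  constructor
  · obtain ⟨Pvb, hPvb⟩ := Arith.exists_isStrongProvabilityPredicate hT hce hPA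
    obtain ⟨Cat, hCat⟩ := Arith.exists_correctlyRepresents hT hPA Arith.sigma1_concatFun
    exact ⟨_, Pvb, Cat, hPvb, hCat, rfl⟩
  · rintro hcons _ Pvb Cat hPvb hCat rfl
    exact Arith.consistencyStatement_not_mem hT hPA hcons hPvb hCat
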